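/- **Setting.** A hypergraph $g=(V,E,\mathrm{att},\mathrm{lab},\mathrm{ext})$ has a finite nonempty node set $V$, a finite set $E$ of edges, each edge $e$ being attached to a nonempty sequence $\mathrm{att}(e)$ of pairwise distinct nodes and labelled by a symbol of rank $\mathrm{rank}(e)=|\mathrm{att}(e)|$, and a sequence $\mathrm{ext}$ of pairwise distinct external nodes; $\mathrm{rank}(g)=|\mathrm{ext}|$. Its size is $|g|=|V|+\sum_{e\in E}s(\mathrm{rank}(e))$, where $s(j)=1$ for $j\le 2$ and $s(j)=j$ for $j>2$. A grammar $G$ consists of a start graph $S$ and one rule $A\to \mathrm{rhs}(A)$ with $\mathrm{rank}(\mathrm{rhs}(A))=\mathrm{rank}(A)$ for each nonterminal $A$; $|G|$ is the sum of the sizes of all right-hand sides, including $S$. A digram is a hypergraph $d$ with exactly two edges, which share a node, without isolated nodes, and with $\mathrm{ext}_d\neq\varepsilon$. An occurrence of $d$ in $g$ is a set $o$ of two edges of $g$ which, together with their nodes, form a copy of $d$ (labels and attachment sequences being preserved) such that a node of the copy corresponds to an external node of $d$ if and only if it is attached to an edge of $g$ outside $o$ or is external in $g$. Two occurrences overlap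 if they share an edge. gRePair with maximal rank $r\in\mathbb N\cup\{\infty\}$ works on a graph $g$ as follows. Start with $S=g$ and no rules. As long as some digram of rank at most $r$ has at least two non-overlapping occurrences in $S$, choose a digram $d$ of rank at most $r$ with the largest number of pairwise non-overlapping occurrences, choose a maximum set of such occurrences, replace each of them by an edge labelled by a fresh nonterminal $A$ (attached to the images of $\mathrm{ext}_d$; the images of internal nodes of $d$ are deleted), and add the rule $A\to d$. Then, if $S$ is disconnected, connect its components by virtual edges and run the loop again. Then prune: remove (by applying its rule everywhere) every nonterminal that is referenced exactly once, then traverse the remaining nonterminals bottom-up and remove each $A$ whose current contribution $|\mathrm{ref}(A)|\,(|\mathrm{rhs}(A)|-|\mathrm{handle}(A)|)-|\mathrm{rhs}(A)|$ is at most $0$, where $|\mathrm{ref}(A)|$ is the number of $A$-labelled edges in the grammar and $|\mathrm{handle}(A)|=\mathrm{rank}(A)+s(\mathrm{rank}(A))$. Finally delete the virtual edges. All remaining choices are arbitrary. For $n\ge 0$ and $k\ge 1$ let $s_{n,k}$ be the right comb with $2^n$ nodes labelled $f_k$, each having $k$ children: the first $k-1$ children are leaves labelled $a$, and the last child is the next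 $f_k$-node, except that the last $f_k$-node has only $a$-labelled leaves as children. Let $g_{n,k}$ be its tree-graph: its nodes are the nodes of $s_{n,k}$, the root is the only external node, and each tree node $u$ with label $\sigma$ and children $u_1,\dots,u_j$ (from left to right) yields one edge labelled $\sigma$ attached to $u\,u_1\cdots u_j$. **Lemma.** 1. There is a constant $C$ such that for all $n\ge 0$, $k\ge 1$ and every maximal rank $r\ge\max(k,2)$, gRePair with maximal rank $r$ produces an output on $g_{n,k}$, and each of its possible outputs $G$ satisfies $|G|\le C\,(k^2+n)$. 2. For all $n\ge 0$, $k\ge 1$ and every maximal rank $r<k$, gRePair with maximal rank $r$ does not compress $g_{n,k}$ at all: its only output is the grammar without nonterminals whose start graph is $g_{n,k}$, which has size $|g_{n,k}|$. -/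

import Mathlib

namespace GRePair

/-! ### Hypergraphs -/

/-- Ranked symbols.  A symbol consists of its name together with its rank; the alphabet of terminals
and the alphabet of nonterminals are disjoint.  `virt` is a reserved terminal of rank two, the label
of the virtual edges which connect the components of a disconnected graph. -/
inductive Symb where
  | term (name rank : ℕ) : Symb
  | nonterm (name rank : ℕ) : Symb
  | virt : Symb
deriving DecidableEq

/-- The rank of a symbol. -/
def Symb.rank : Symb → ℕ
  | .term _ r => r
  | .nonterm _ r => r
  | .virt => 2

/-- A hyperedge: its label and the sequence of nodes to which it is attached. -/
structure Edge where
  lab : Symb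
  att : List ℕ
deriving DecidableEq

/-- The rank of an edge is the number of nodes to which it is attached. -/
def Edge.rank (e : Edge) : ℕ := e.att.length

/-- Renaming of the nodes of an edge. -/
def Edge.rename (ρ : ℕ → ℕ) (e : Edge) : Edge := ⟨e.lab, e.att.map ρ⟩

/-- A hypergraph `(V, E, att, lab, ext)`.  The family of edges with their labels and attachments is
recorded as a multiset of pairs `(lab e, att e)`, so that parallel edges with the same label are
counted with multiplicity. -/
structure HGraph where
  V : Finset ℕ
  E : Multiset Edge
  ext : List ℕ

/-- The requirements on hypergraphs: there is a node, every edge is attached to at least one node,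
the number of attached nodes is the rank of the label, no edge is attached to a node twice, and no
node is external twice. -/
structure HGraph.IsHypergraph (g : HGraph) : Prop where
  nonempty : g.V.Nonempty
  att_subset : ∀ e ∈ g.E, ∀ v ∈ e.att, v ∈ g.V
  att_nodup : ∀ e ∈ g.E, e.att.Nodup
  att_ne_nil : ∀ e ∈ g.E, e.att ≠ []
  rank_lab : ∀ e ∈ g.E, e.rank = e.lab.rank
  ext_subset : ∀ v ∈ g.ext, v ∈ g.V
  ext_nodup : g.ext.Nodup

/-- The rank of a hypergraph is the number of its external nodes. -/
def HGraph.rank (g : HGraph) : ℕ := g.ext.length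

/-- The size of an edge of rank `r`. -/
def edgeSize (r : ℕ) : ℕ := if r ≤ 2 then 1 else r

/-- The size of a hypergraph: the number of nodes plus the sizes of the edges. -/
def HGraph.size (g : HGraph) : ℕ := g.V.card + (g.E.map fun e => edgeSize e.rank).sum

/-- The number of edges with label `A`. -/
def HGraph.countLab (g : HGraph) (A : Symb) : ℕ := (g.E.filter fun e => e.lab = A).card

/-! ### Digrams and their occurrences -/

/-- A digram: a hypergraph with exactly two edges which share a node, without isolated nodes, and
with at least one external node. -/
def HGraph.IsDigram (d : HGraph) : Prop :=
  d.IsHypergraph ∧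
  ∃ e₁ e₂ : Edge, d.E = {e₁, e₂} ∧
    (∀ v ∈ d.V, v ∈ e₁.att ∨ v ∈ e₂.att) ∧
    (∃ v ∈ d.V, v ∈ e₁.att ∧ v ∈ e₂.att) ∧
    d.ext ≠ []

/-- The pair of edges which is the image of the digram `d` under the node map `φ`. -/
def occEdges (d : HGraph) (φ : ℕ → ℕ) : Multiset Edge := d.E.map (Edge.rename φ)

/-- `φ` describes an occurrence of the digram `d` in `g`: it embeds `d` into `g` (so that the two
edges `occEdges d φ` induce a copy of `d`), and a node of `d` is external if and only if its image
is attached to a further edge of `g` or is an external node of `g`. -/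
structure IsOccurrence (g d : HGraph) (φ : ℕ → ℕ) : Prop where
  inj : Set.InjOn φ d.V
  edges_le : occEdges d φ ≤ g.E
  ext_iff : ∀ v ∈ d.V,
    v ∈ d.ext ↔ (∃ e ∈ g.E - occEdges d φ, φ v ∈ e.att) ∨ φ v ∈ g.ext

/-- `L` is a list of pairwise non-overlapping occurrences of `d` in `g`: no edge of `g` is used by
two of them. -/
def IsNonOverlapping (g d : HGraph) (L : List (ℕ → ℕ)) : Prop :=
  (∀ φ ∈ L, IsOccurrence g d φ) ∧ (L.map (occEdges d)).sum ≤ g.E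

/-- `d` is an active digram of rank at most `r` in `g`: it has at least two non-overlapping
occurrences. -/
def IsActive (r : ℕ∞) (g d : HGraph) : Prop :=
  d.IsDigram ∧ (d.rank : ℕ∞) ≤ r ∧ ∃ L, IsNonOverlapping g d L ∧ 2 ≤ L.length

/-- Among the digrams of rank at most `r`, `d` is one with the largest number of non-overlapping
occurrences in `g`, and `L` is a maximum list of non-overlapping occurrences of `d`. -/
def IsMostFrequent (r : ℕ∞) (g d : HGraph) (L : List (ℕ → ℕ)) : Prop :=
  d.IsDigram ∧ (d.rank : ℕ∞) ≤ r ∧ IsNonOverlapping g d L ∧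
    ∀ (d' : HGraph) (L' : List (ℕ → ℕ)), d'.IsDigram → (d'.rank : ℕ∞) ≤ r →
      IsNonOverlapping g d' L' → L'.length ≤ L.length

open Classical in
/-- Replacement in `g` of all the occurrences of `d` in the list `L` by edges with label `A`: the two
edges and the removal nodes (the images of the internal nodes of `d`) of each occurrence are removed,
and a new `A`-edge is attached to its attachment nodes, in the order given by the external nodes of
`d`. -/
noncomputable def replaceOccs (g d : HGraph) (A : Symb) (L : List (ℕ → ℕ)) : HGraph where
  V := g.V.filter fun v => ¬ ∃ φ ∈ L, ∃ u ∈ d.V, u ∉ d.ext ∧ φ u = v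
  E := g.E - (L.map (occEdges d)).sum +
    ((L.map fun φ => (⟨A, d.ext.map φ⟩ : Edge) : List Edge) : Multiset Edge)
  ext := g.ext

/-! ### Grammars -/

/-- A hyperedge replacement grammar: its start graph and its rules `(A, rhs A)`.  The nonterminals
are the left-hand sides of the rules. -/
structure Grammar where
  start : HGraph
  rules : Multiset (Symb × HGraph)

/-- The grammar without nonterminals whose start graph is `g`. -/
def Grammar.ofGraph (g : HGraph) : Grammar := ⟨g, 0⟩

/-- The size of a grammar: the sum of the sizes of all right-hand sides, including the start
graph. -/
def Grammar.size (G : Grammar) : ℕ := G.start.size + (G.rules.map fun p => p.2.size).sum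

/-- The number of edges with label `A` in the whole grammar. -/
def Grammar.ref (G : Grammar) (A : Symb) : ℕ :=
  G.start.countLab A + (G.rules.map fun p => p.2.countLab A).sum

/-- The symbol `A` does not occur in the grammar. -/
def Grammar.IsFresh (G : Grammar) (A : Symb) : Prop :=
  G.ref A = 0 ∧ ∀ p ∈ G.rules, p.1 ≠ A

/-! ### The replacement loop -/

/-- One iteration of the replacement loop with maximal rank `r`. -/
def LoopStep (r : ℕ∞) (G G' : Grammar) : Prop :=
  ∃ (d : HGraph) (L : List (ℕ → ℕ)) (i : ℕ),
    IsMostFrequent r G.start d L ∧ 2 ≤ L.length ∧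
    G.IsFresh (.nonterm i d.rank) ∧
    G' = ⟨replaceOccs G.start d (.nonterm i d.rank) L, (.nonterm i d.rank, d) ::ₘ G.rules⟩

/-- `G'` is a possible result of the replacement loop started with `G`: the loop is iterated until
there is no active digram left. -/
def LoopResult (r : ℕ∞) (G G' : Grammar) : Prop :=
  Relation.ReflTransGen (LoopStep r) G G' ∧ ∀ d, ¬ IsActive r G'.start d

/-! ### Virtual edges -/

/-- Any two nodes of the graph are joined by a chain of edges. -/
def HGraph.IsConnected (g : HGraph) : Prop :=
  ∀ u ∈ g.V, ∀ v ∈ g.V,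
    Relation.ReflTransGen (fun x y => ∃ e ∈ g.E, x ∈ e.att ∧ y ∈ e.att) u v

/-- Addition of edges to a graph. -/
def HGraph.addEdges (g : HGraph) (F : Multiset Edge) : HGraph := ⟨g.V, g.E + F, g.ext⟩

/-- The components of the start graph are connected by virtual edges, without any superfluous
virtual edge.  In particular a connected start graph is left unchanged. -/
def ConnectVirtual (G G' : Grammar) : Prop :=
  ∃ F : Multiset Edge,
    (∀ e ∈ F, e.lab = .virt ∧ e.att.length = 2 ∧ e.att.Nodup ∧ ∀ v ∈ e.att, v ∈ G.start.V) ∧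
    (G.start.addEdges F).IsConnected ∧
    (∀ F' < F, ¬ (G.start.addEdges F').IsConnected) ∧
    G' = ⟨G.start.addEdges F, G.rules⟩

/-- Removal of the virtual edges from a graph. -/
def HGraph.dropVirtual (g : HGraph) : HGraph := ⟨g.V, g.E.filter fun e => e.lab ≠ .virt, g.ext⟩

/-- Removal of the virtual edges from a grammar. -/
def Grammar.dropVirtual (G : Grammar) : Grammar :=
  ⟨G.start.dropVirtual, G.rules.map fun p => (p.1, p.2.dropVirtual)⟩

/-! ### Pruning -/

/-- `g'` is obtained from `g` by applying the rule `A → h` to one edge `e` labelled `A`: the edge `e`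
is removed and a copy of `h` is added, the external nodes of which are the nodes attached to `e`, and
the internal nodes of which are new. -/
def Derives (A : Symb) (h g g' : HGraph) : Prop :=
  ∃ (e : Edge) (ρ : ℕ → ℕ), e ∈ g.E ∧ e.lab = A ∧ Set.InjOn ρ h.V ∧ h.ext.map ρ = e.att ∧
    (∀ v ∈ h.V, v ∉ h.ext → ρ v ∉ g.V) ∧
    g' = ⟨g.V ∪ h.V.image ρ, g.E.erase e + h.E.map (Edge.rename ρ), g.ext⟩

/-- `g'` is obtained from `g` by applying the rule `A → h` to every edge labelled `A`. -/
def DerivesAll (A : Symb) (h g g' : HGraph) : Prop :=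
  Relation.ReflTransGen (Derives A h) g g' ∧ g'.countLab A = 0

/-- `G'` is obtained from `G` by removing the nonterminal `A` with right-hand side `h`: its rule is
applied to every `A`-edge of the grammar, and is then deleted. -/
def RemoveNonterminal (A : Symb) (h : HGraph) (G G' : Grammar) : Prop :=
  ∃ R : Multiset (Symb × HGraph), G.rules = (A, h) ::ₘ R ∧
    DerivesAll A h G.start G'.start ∧
    Multiset.Rel (fun p q => p.1 = q.1 ∧ DerivesAll A h p.2 q.2) R G'.rules

/-- The size of the handle of a nonterminal of rank `n`: the graph with `n` nodes, all external, and
one edge attached to them. -/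
def handleSize (n : ℕ) : ℕ := n + edgeSize n

/-- The contribution `|ref(A)| (|rhs(A)| - |handle(A)|) - |rhs(A)|` of the nonterminal `A` with
right-hand side `h`. -/
def Grammar.con (G : Grammar) (A : Symb) (h : HGraph) : ℤ :=
  (G.ref A : ℤ) * ((h.size : ℤ) - (handleSize A.rank : ℤ)) - (h.size : ℤ)

/-- Removal of one nonterminal which is referenced exactly once. -/
def PruneOnceStep (G G' : Grammar) : Prop :=
  ∃ A h, (A, h) ∈ G.rules ∧ G.ref A = 1 ∧ RemoveNonterminal A h G G'

/-- `G'` is obtained from `G` by removing nonterminals which are referenced exactly once until there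
are none left. -/
def PruneOnce (G G' : Grammar) : Prop :=
  Relation.ReflTransGen PruneOnceStep G G' ∧ ∀ p ∈ G'.rules, G'.ref p.1 ≠ 1

/-- `l` lists the nonterminals of `G` bottom-up: the right-hand side of a nonterminal refers only to
nonterminals which precede it in the list. -/
def IsBottomUp (G : Grammar) (l : List Symb) : Prop :=
  (l : Multiset Symb) = G.rules.map Prod.fst ∧
  l.Pairwise fun A B => ∀ h, (A, h) ∈ G.rules → h.countLab B = 0 ∧ A ≠ B

/-- The nonterminals in the list are visited one after the other, and each nonterminal the
contribution of which is not positive at that moment is removed. -/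
inductive PruneTraverse : List Symb → Grammar → Grammar → Prop
  | done (G : Grammar) : PruneTraverse [] G G
  | remove {A : Symb} {l : List Symb} {h : HGraph} {G G' G'' : Grammar} :
      (A, h) ∈ G.rules → G.con A h ≤ 0 → RemoveNonterminal A h G G' →
      PruneTraverse l G' G'' → PruneTraverse (A :: l) G G''
  | keep {A : Symb} {l : List Symb} {h : HGraph} {G G' : Grammar} :
      (A, h) ∈ G.rules → 0 < G.con A h →
      PruneTraverse l G G' → PruneTraverse (A :: l) G G'

/-- The pruning step: first the nonterminals which are referenced exactly once are removed, then the
remaining nonterminals are traversed bottom-up and those which do not contribute are removed. -/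
def Prune (G G' : Grammar) : Prop :=
  ∃ (G₁ : Grammar) (l : List Symb), PruneOnce G G₁ ∧ IsBottomUp G₁ l ∧ PruneTraverse l G₁ G'

/-! ### The compressor -/

/-- `G` is a possible output of gRePair with maximal rank `r` on the graph `g`: replacement loop,
connection of the components by virtual edges, second run of the replacement loop, pruning, removal
of the virtual edges.  All choices which the algorithm leaves open are left open. -/
def IsOutput (r : ℕ∞) (g : HGraph) (G : Grammar) : Prop :=
  ∃ G₁ G₂ G₃ G₄ : Grammar,
    LoopResult r (Grammar.ofGraph g) G₁ ∧ ConnectVirtual G₁ G₂ ∧ LoopResult r G₂ G₃ ∧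
    Prune G₃ G₄ ∧ G = G₄.dropVirtual

/-! ### Trees and tree-graphs -/

/-- Ordered trees, the nodes of which are labelled by names of symbols.  The rank of the symbol at a
node is its number of children. -/
inductive OrdTree where
  | node (label : ℕ) (children : List OrdTree) : OrdTree

mutual
/-- The number of nodes of a tree. -/
def OrdTree.numNodes : OrdTree → ℕ
  | .node _ cs => 1 + OrdTree.numNodesList cs
/-- The number of nodes of a forest. -/
def OrdTree.numNodesList : List OrdTree → ℕ
  | [] => 0
  | c :: cs => OrdTree.numNodes c + OrdTree.numNodesList cs
end

/-- The positions of the roots of the trees of a forest, if the nodes of the forest are numbered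
consecutively in lexicographical order of their addresses (that is, in pre-order) starting with
`s`. -/
def OrdTree.rootPositions : List OrdTree → ℕ → List ℕ
  | [], _ => []
  | c :: cs, s => s :: OrdTree.rootPositions cs (s + c.numNodes)

mutual
/-- The edges of the tree-graph of a tree, the nodes of which are numbered in pre-order starting with
`s`.  A tree node with `k` children becomes an edge of rank `k + 1`, attached to the tree node and
then to its children from left to right. -/
def OrdTree.graphEdges : OrdTree → ℕ → Multiset Edge
  | .node a cs, s =>
    ⟨.term a (cs.length + 1), s :: OrdTree.rootPositions cs (s + 1)⟩ ::ₘ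
      OrdTree.graphEdgesList cs (s + 1)
/-- The edges of the tree-graphs of the trees of a forest. -/
def OrdTree.graphEdgesList : List OrdTree → ℕ → Multiset Edge
  | [], _ => 0
  | c :: cs, s => OrdTree.graphEdges c s + OrdTree.graphEdgesList cs (s + c.numNodes)
end

/-- The tree-graph of a tree.  Its nodes are the positions of the tree nodes in pre-order, and its
only external node is the root. -/
def OrdTree.tGraph (t : OrdTree) : HGraph := ⟨Finset.range t.numNodes, t.graphEdges 0, [0]⟩

/-- The right comb with `m` nodes labelled `f` (name `1`), each with `k` children: the first `k - 1`
children are leaves labelled `a` (name `0`), and the last child is the next `f`-labelled node, except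
for the last `f`-labelled node, which has only `a`-labelled children. -/
def comb (k : ℕ) : ℕ → OrdTree
  | 0 => .node 0 []
  | m + 1 => .node 1 (List.replicate (k - 1) (.node 0 []) ++ [comb k m])

/-- The tree-graph of the right comb with `2 ^ n` nodes labelled `f_k`. -/
def combGraph (n k : ℕ) : HGraph := (comb k (2 ^ n)).tGraph

end GRePair

/-!
The replacement loop keeps the start graph of a comb in the following shape: a chain of `2 ^ j`
translates of one edge with attachment list `π`, consecutive ones sharing a node, and a leaf edge at
every node which is not the first node of a chain edge. While `π` has more than two entries, the
digrams with the most disjoint occurrences consist of a chain edge and the leaf edge at one of its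
inner positions: they occur `2 ^ j` times, have size `O(k)`, and replacing them shortens `π` by one
entry. Once `π` has two entries, the most frequent digram consists of two consecutive chain edges;
it has bounded size, and replacing it halves the chain. So the rules have total size `O(k ^ 2 + n)`.
The start graph stays connected, hence there are no virtual edges, and pruning never increases the
size.

Every digram which occurs in such a graph has rank at least `|π| - 1`, which is `k` for the comb
itself. Therefore the loop does not start if the maximal rank is less than `k`.
-/

namespace GRePair

/-! ### Sound graphs and applications of a rule -/

/-- The conditions on hypergraphs that the replacement of edges has to preserve: edges are attached
to nodes of the graph, without repetition, and in accordance with the ranks of their labels. -/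
structure HGraph.Sound (g : HGraph) : Prop where
  att_subset : ∀ e ∈ g.E, ∀ v ∈ e.att, v ∈ g.V
  att_nodup : ∀ e ∈ g.E, e.att.Nodup
  rank_lab : ∀ e ∈ g.E, e.rank = e.lab.rank

/-- Well-formedness of the rule `A → h`. -/
structure SoundRule (A : Symb) (h : HGraph) : Prop where
  sound : h.Sound
  ext_subset : ∀ v ∈ h.ext, v ∈ h.V
  ext_nodup : h.ext.Nodup
  rank_eq : h.rank = A.rank

lemma HGraph.IsHypergraph.sound {g : HGraph} (hg : g.IsHypergraph) : g.Sound :=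
  ⟨hg.att_subset, hg.att_nodup, hg.rank_lab⟩

@[simp] lemma Edge.rename_lab (ρ : ℕ → ℕ) (e : Edge) : (e.rename ρ).lab = e.lab := rfl

@[simp] lemma Edge.rename_att (ρ : ℕ → ℕ) (e : Edge) : (e.rename ρ).att = e.att.map ρ := rfl

@[simp] lemma Edge.rename_rank (ρ : ℕ → ℕ) (e : Edge) : (e.rename ρ).rank = e.rank := by
  simp [Edge.rank]

lemma Edge.mem_att_rename_iff {ρ : ℕ → ℕ} {e : Edge} {V : Set ℕ} (he : ∀ v ∈ e.att, v ∈ V)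
    (hρ : Set.InjOn ρ V) {v : ℕ} (hv : v ∈ V) : ρ v ∈ (e.rename ρ).att ↔ v ∈ e.att :=
  List.mem_map.trans ⟨fun ⟨u, hu, huv⟩ => hρ (he u hu) hv huv ▸ hu, fun h => ⟨v, h, rfl⟩⟩

/-- Renaming of the nodes of a hypergraph; the result is a copy of the graph only if the renaming is
injective on its nodes. -/
def HGraph.rename (ρ : ℕ → ℕ) (g : HGraph) : HGraph :=
  ⟨g.V.image ρ, g.E.map (Edge.rename ρ), g.ext.map ρ⟩

lemma HGraph.countLab_eq_countP (g : HGraph) (A : Symb) :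
    g.countLab A = g.E.countP fun e => e.lab = A := by
  rw [HGraph.countLab, Multiset.countP_eq_card_filter]

lemma HGraph.countLab_eq_zero {g : HGraph} {A : Symb} :
    g.countLab A = 0 ↔ ∀ e ∈ g.E, e.lab ≠ A := by
  rw [countLab_eq_countP, Multiset.countP_eq_zero]

lemma countP_map_rename (ρ : ℕ → ℕ) (E : Multiset Edge) (A : Symb) :
    (E.map (Edge.rename ρ)).countP (fun e => e.lab = A) = E.countP fun e => e.lab = A := by
  rw [Multiset.countP_map, Multiset.countP_eq_card_filter]
  rfl

lemma sum_edgeSize_map_rename (ρ : ℕ → ℕ) (E : Multiset Edge) :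
    ((E.map (Edge.rename ρ)).map fun e => edgeSize e.rank).sum =
      (E.map fun e => edgeSize e.rank).sum := by
  simp only [Multiset.map_map, Function.comp_def, Edge.rename_rank]

lemma exists_injective_map_eq {α : Type*} [Infinite α] {l l' : List α} {s : Finset α}
    (hl : l.Nodup) (hl' : l'.Nodup) (hlen : l.length = l'.length) (hs : ∀ v ∈ l', v ∈ s) :
    ∃ ρ : α → α, ρ.Injective ∧ l.map ρ = l' ∧ ∀ v, v ∉ l → ρ v ∉ s := by
  classical
  obtain ⟨f⟩ : Nonempty (α ≃ ((s : Set α)ᶜ : Set α)) :=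
    Cardinal.eq.1 (Cardinal.mk_compl_finset_of_infinite s).symm
  let ρ : α → α := fun v => l'[l.idxOf v]?.getD (f v)
  have hρl (v : α) (hv : v ∈ l) : ∃ hi : l.idxOf v < l'.length, ρ v = l'[l.idxOf v] := by
    have hi : l.idxOf v < l'.length := hlen ▸ List.idxOf_lt_length_iff.2 hv
    exact ⟨hi, by simp only [ρ, List.getElem?_eq_getElem hi, Option.getD_some]⟩
  have hρs (v : α) : ρ v ∈ s ↔ v ∈ l := by
    refine ⟨fun h => ?_, fun hv => ?_⟩
    · by_contra hv
      have h1 : ρ v = f v := by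
        simp only [ρ, List.idxOf_eq_length hv, hlen, List.getElem?_length, Option.getD_none]
      exact (f v).2 (h1 ▸ h)
    · obtain ⟨hi, h1⟩ := hρl v hv
      exact h1 ▸ hs _ (List.getElem_mem hi)
  refine ⟨ρ, fun x y hxy => ?_, List.ext_getElem (by simpa using hlen) fun i h1 h2 => ?_,
    fun v hv => (hρs v).not.2 hv⟩
  · by_cases hx : x ∈ l
    · obtain ⟨hi, h1⟩ := hρl x hx
      obtain ⟨hj, h2⟩ := hρl y ((hρs y).1 (hxy ▸ (hρs x).2 hx))
      rw [h1, h2, hl'.getElem_inj_iff] at hxy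
      exact (List.idxOf_inj hx).1 hxy
    · have hy : y ∉ l := fun hy => hx ((hρs x).1 (hxy ▸ (hρs y).2 hy))
      simp only [ρ, List.idxOf_eq_length hx, List.idxOf_eq_length hy, hlen, List.getElem?_length,
        Option.getD_none] at hxy
      exact f.injective (Subtype.ext hxy)
  · rw [List.length_map] at h1
    obtain ⟨hi, h3⟩ := hρl l[i] (List.getElem_mem h1)
    simp only [List.getElem_map, h3, hl.idxOf_getElem i h1]

section Derives

variable {A : Symb} {h g g' : HGraph}

lemma Derives.ext_eq (hd : Derives A h g g') : g'.ext = g.ext := by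
  obtain ⟨e, ρ, -, -, -, -, -, rfl⟩ := hd
  rfl

lemma Derives.V_subset (hd : Derives A h g g') : g.V ⊆ g'.V := by
  obtain ⟨e, ρ, -, -, -, -, -, rfl⟩ := hd
  exact Finset.subset_union_left

lemma Derives.countLab_add (hd : Derives A h g g') (B : Symb) :
    g'.countLab B + (if A = B then 1 else 0) = g.countLab B + h.countLab B := by
  obtain ⟨e, ρ, he, hA, -, -, -, rfl⟩ := hd
  obtain ⟨R, hR⟩ := Multiset.exists_cons_of_mem he
  simp only [HGraph.countLab_eq_countP, hR, Multiset.erase_cons_head, Multiset.countP_add,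
    countP_map_rename, Multiset.countP_cons, hA]
  split_ifs <;> omega

lemma HGraph.Sound.rename (hh : h.Sound) {ρ : ℕ → ℕ} (hρ : Set.InjOn ρ h.V) :
    (h.rename ρ).Sound where
  att_subset := by
    simp only [HGraph.rename, Multiset.mem_map, forall_exists_index, and_imp,
      forall_apply_eq_imp_iff₂, Edge.rename_att, List.mem_map]
    exact fun e he v hv => Finset.mem_image_of_mem _ (hh.att_subset e he v hv)
  att_nodup := by
    simp only [HGraph.rename, Multiset.mem_map, forall_exists_index, and_imp,
      forall_apply_eq_imp_iff₂]
    exact fun e he => (hh.att_nodup e he).map_on fun x hx y hy =>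
      hρ (hh.att_subset e he x hx) (hh.att_subset e he y hy)
  rank_lab := by
    simpa only [HGraph.rename, Multiset.mem_map, forall_exists_index, and_imp,
      forall_apply_eq_imp_iff₂, Edge.rename_rank, Edge.rename_lab] using hh.rank_lab

lemma Derives.sound (hh : h.Sound) (hg : g.Sound) (hd : Derives A h g g') : g'.Sound := by
  obtain ⟨e, ρ, -, -, hinj, -, -, rfl⟩ := hd
  have hc := hh.rename hinj
  have hmem {f : Edge} (hf : f ∈ g.E.erase e + h.E.map (Edge.rename ρ)) :
      f ∈ g.E ∨ f ∈ h.E.map (Edge.rename ρ) :=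
    (Multiset.mem_add.1 hf).imp_left Multiset.mem_of_mem_erase
  exact
    { att_subset := fun f hf v hv => Finset.mem_union.2 <| (hmem hf).imp
        (fun hf => hg.att_subset f hf v hv) (fun hf => hc.att_subset f hf v hv)
      att_nodup := fun f hf => (hmem hf).elim (hg.att_nodup f) (hc.att_nodup f)
      rank_lab := fun f hf => (hmem hf).elim (hg.rank_lab f) (hc.rank_lab f) }

lemma Derives.size_le (hr : SoundRule A h) (hg : g.Sound) (hd : Derives A h g g') :
    g'.size + handleSize A.rank ≤ g.size + h.size := by
  obtain ⟨e, ρ, he, hA, -, hext, -, rfl⟩ := hd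
  have hrank : e.rank = A.rank := by rw [hg.rank_lab e he, hA]
  have hV : (g.V ∪ h.V.image ρ).card + A.rank ≤ g.V.card + h.V.card := by
    have hinternal : (h.V \ h.ext.toFinset).card + A.rank = h.V.card := by
      rw [← hr.rank_eq, HGraph.rank, ← List.toFinset_card_of_nodup hr.ext_nodup]
      exact Finset.card_sdiff_add_card_eq_card fun v hv => hr.ext_subset v (List.mem_toFinset.1 hv)
    have hsub : g.V ∪ h.V.image ρ ⊆ g.V ∪ (h.V \ h.ext.toFinset).image ρ := by
      refine Finset.union_subset Finset.subset_union_left fun v hv => ?_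
      obtain ⟨u, hu, rfl⟩ := Finset.mem_image.1 hv
      by_cases hue : u ∈ h.ext
      · exact Finset.mem_union_left _ (hg.att_subset e he _ (hext ▸ List.mem_map_of_mem hue))
      · exact Finset.mem_union_right _ (Finset.mem_image_of_mem _ (by simp [hu, hue]))
    have := (Finset.card_le_card hsub).trans ((Finset.card_union_le _ _).trans
      (Nat.add_le_add_left Finset.card_image_le _))
    omega
  obtain ⟨R, hR⟩ := Multiset.exists_cons_of_mem he
  simp only [HGraph.size, handleSize, hR, Multiset.erase_cons_head, Multiset.map_add,
    sum_edgeSize_map_rename, Multiset.sum_add, Multiset.map_cons, Multiset.sum_cons, hrank]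
  omega

lemma exists_derives (hr : SoundRule A h) (hg : g.Sound) (hA : g.countLab A ≠ 0) :
    ∃ g', Derives A h g g' := by
  rw [Ne, HGraph.countLab_eq_zero] at hA
  push Not at hA
  obtain ⟨e, he, rfl⟩ := hA
  obtain ⟨ρ, hinj, hext, hnew⟩ := exists_injective_map_eq hr.ext_nodup (hg.att_nodup e he)
    (hr.rank_eq.trans (hg.rank_lab e he).symm) (hg.att_subset e he)
  exact ⟨_, e, ρ, he, rfl, hinj.injOn, hext, fun v _ => hnew v, rfl⟩

lemma DerivesAll.sound (hh : h.Sound) (hg : g.Sound) (hd : DerivesAll A h g g') : g'.Sound := by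
  obtain ⟨hd, -⟩ := hd
  induction hd with
  | refl => exact hg
  | tail _ hs ih => exact hs.sound hh ih

lemma DerivesAll.ext_eq (hd : DerivesAll A h g g') : g'.ext = g.ext := by
  obtain ⟨hd, -⟩ := hd
  induction hd with
  | refl => rfl
  | tail _ hs ih => exact hs.ext_eq.trans ih

lemma DerivesAll.V_subset (hd : DerivesAll A h g g') : g.V ⊆ g'.V := by
  obtain ⟨hd, -⟩ := hd
  induction hd with
  | refl => rfl
  | tail _ hs ih => exact ih.trans hs.V_subset

lemma DerivesAll.eq_of_countLab_eq_zero (hd : DerivesAll A h g g') (hA : g.countLab A = 0) :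
    g' = g := by
  rcases Relation.ReflTransGen.cases_head hd.1 with heq | ⟨g₁, ⟨e, ρ, he, hl, -⟩, -⟩
  · exact heq.symm
  · exact absurd hl (HGraph.countLab_eq_zero.1 hA e he)

lemma DerivesAll.countLab_eq_zero (hd : DerivesAll A h g g') {B : Symb} (hB : g.countLab B = 0)
    (hAB : g.countLab A ≠ 0 → h.countLab B = 0) : g'.countLab B = 0 := by
  by_cases hA : g.countLab A = 0
  · rw [hd.eq_of_countLab_eq_zero hA, hB]
  · obtain ⟨hd, -⟩ := hd
    have hhB := hAB hA
    induction hd with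
    | refl => exact hB
    | tail _ hs ih => have := hs.countLab_add B; omega

lemma DerivesAll.soundRule (hh : h.Sound) {B : Symb} (hg : SoundRule B g)
    (hd : DerivesAll A h g g') : SoundRule B g' where
  sound := hd.sound hh hg.sound
  ext_subset := hd.ext_eq ▸ fun v hv => hd.V_subset (hg.ext_subset v hv)
  ext_nodup := hd.ext_eq ▸ hg.ext_nodup
  rank_eq := (congrArg List.length hd.ext_eq).trans hg.rank_eq

lemma DerivesAll.size_le (hr : SoundRule A h) (hA : h.countLab A = 0) (hg : g.Sound)
    (hd : DerivesAll A h g g') :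
    (g'.size : ℤ) ≤ g.size + g.countLab A * ((h.size : ℤ) - handleSize A.rank) := by
  obtain ⟨hd, hA'⟩ := hd
  suffices (g'.size : ℤ) + g'.countLab A * ((h.size : ℤ) - handleSize A.rank) ≤
      g.size + g.countLab A * ((h.size : ℤ) - handleSize A.rank) ∧ g'.Sound by
    simpa [hA'] using this.1
  clear hA'
  induction hd with
  | refl => exact ⟨le_rfl, hg⟩
  | @tail b c _ hs ih =>
    refine ⟨le_trans ?_ ih.1, hs.sound hr.sound ih.2⟩
    have hsize := hs.size_le hr ih.2
    have hcount := hs.countLab_add A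
    rw [if_pos rfl, hA, add_zero] at hcount
    rw [← hcount]
    push_cast
    linarith

lemma exists_derivesAll (hr : SoundRule A h) (hA : h.countLab A = 0) (hg : g.Sound) :
    ∃ g', DerivesAll A h g g' := by
  induction hn : g.countLab A generalizing g with
  | zero => exact ⟨g, .refl, hn⟩
  | succ n ih =>
    obtain ⟨g₁, hstep⟩ := exists_derives hr hg (by omega)
    have hcount := hstep.countLab_add A
    rw [if_pos rfl, hA] at hcount
    obtain ⟨g₂, hsteps, hzero⟩ := ih (hstep.sound hr.sound hg) (by omega)
    exact ⟨g₂, .head hstep hsteps, hzero⟩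

end Derives

/-! ### Sound grammars and pruning -/

/-- Well-formed grammars: the right-hand sides are sound, every nonterminal has only one rule, and
the references between nonterminals are acyclic, as witnessed by a height of the symbols. -/
structure Grammar.Sound (G : Grammar) : Prop where
  start : G.start.Sound
  rules : ∀ p ∈ G.rules, SoundRule p.1 p.2
  nodup : (G.rules.map Prod.fst).Nodup
  acyclic : ∃ height : Symb → ℕ, ∀ p ∈ G.rules, ∀ B, p.2.countLab B ≠ 0 → height B < height p.1

lemma Grammar.Sound.ofGraph {g : HGraph} (hg : g.Sound) : (Grammar.ofGraph g).Sound where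
  start := hg
  rules := by simp [Grammar.ofGraph]
  nodup := by simp [Grammar.ofGraph]
  acyclic := ⟨fun _ => 0, by simp [Grammar.ofGraph]⟩

lemma Grammar.Sound.countLab_self {G : Grammar} (hG : G.Sound) {A : Symb} {h : HGraph}
    (hA : (A, h) ∈ G.rules) : h.countLab A = 0 := by
  obtain ⟨height, hh⟩ := hG.acyclic
  by_contra hne
  exact lt_irrefl _ (hh _ hA A hne)

lemma Grammar.Sound.exists_isBottomUp {G : Grammar} (hG : G.Sound) : ∃ l, IsBottomUp G l := by
  obtain ⟨height, hheight⟩ := hG.acyclic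
  let below : Symb → Symb → Prop := fun A B => height A ≤ height B
  have : Std.Total below := ⟨fun A B => le_total (height A) (height B)⟩
  have : IsTrans Symb below := ⟨fun _ _ _ => le_trans⟩
  let l := (G.rules.map Prod.fst).toList
  have hl : (l : Multiset Symb) = G.rules.map Prod.fst := Multiset.coe_toList _
  have hsort : (l.insertionSort below).Pairwise below := List.pairwise_insertionSort below l
  have hnodup : (l.insertionSort below).Nodup :=
    (List.perm_insertionSort below l).nodup_iff.2 (Multiset.coe_nodup.1 (hl ▸ hG.nodup))
  refine ⟨l.insertionSort below, ?_, (hsort.and hnodup).imp ?_⟩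
  · rw [← hl, Multiset.coe_eq_coe]
    exact List.perm_insertionSort below l
  · rintro A B ⟨hAB, hne⟩ h hA
    refine ⟨?_, hne⟩
    by_contra hB
    exact absurd (hheight _ hA B hB) hAB.not_gt

lemma mem_map_fst {R : Multiset (Symb × HGraph)} {A : Symb} :
    A ∈ R.map Prod.fst ↔ ∃ h, (A, h) ∈ R := by
  simp [Multiset.mem_map]

section Remove

variable {A : Symb} {h : HGraph} {G G' : Grammar}

lemma exists_removeNonterminal (hG : G.Sound) (hA : (A, h) ∈ G.rules) :
    ∃ G', RemoveNonterminal A h G G' := by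
  have hexists {g : HGraph} (hg : g.Sound) : ∃ g', DerivesAll A h g g' :=
    exists_derivesAll (hG.rules _ hA) (hG.countLab_self hA) hg
  obtain ⟨R, hR⟩ := Multiset.exists_cons_of_mem hA
  have hsound (p : Symb × HGraph) (hp : p ∈ R) : p.2.Sound :=
    (hG.rules p (hR ▸ Multiset.mem_cons_of_mem hp)).sound
  obtain ⟨s, hs⟩ := hexists hG.start
  have : Nonempty HGraph := ⟨h⟩
  choose! f hf using fun p hp => hexists (hsound p hp)
  refine ⟨⟨s, R.map fun p => (p.1, f p)⟩, R, hR, hs, ?_⟩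
  rw [Multiset.rel_map_right]
  exact Multiset.rel_refl_of_refl_on fun p hp => ⟨rfl, hf p hp⟩

lemma RemoveNonterminal.map_fst (hrm : RemoveNonterminal A h G G') :
    G.rules.map Prod.fst = A ::ₘ G'.rules.map Prod.fst := by
  obtain ⟨R, hR, -, hrel⟩ := hrm
  rw [hR, Multiset.map_cons]
  congr 1
  exact Multiset.rel_eq.1 (Multiset.rel_map.2 (hrel.mono fun _ _ _ _ hpq => hpq.1))

lemma RemoveNonterminal.card_rules (hrm : RemoveNonterminal A h G G') :
    G.rules.card = G'.rules.card + 1 := by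
  simpa using congrArg Multiset.card hrm.map_fst

lemma RemoveNonterminal.mem_rules (hrm : RemoveNonterminal A h G G') : (A, h) ∈ G.rules := by
  obtain ⟨R, hR, -⟩ := hrm
  exact hR ▸ Multiset.mem_cons_self _ _

lemma RemoveNonterminal.exists_derivesAll (hrm : RemoveNonterminal A h G G')
    {q : Symb × HGraph} (hq : q ∈ G'.rules) :
    ∃ g, (q.1, g) ∈ G.rules ∧ DerivesAll A h g q.2 := by
  obtain ⟨R, hR, -, hrel⟩ := hrm
  obtain ⟨p, hp, hpq, hd⟩ := Multiset.exists_mem_of_rel_of_mem (Multiset.rel_flip.2 hrel) hq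
  exact ⟨p.2, hpq ▸ hR ▸ Multiset.mem_cons_of_mem hp, hd⟩

lemma RemoveNonterminal.sound (hG : G.Sound) (hrm : RemoveNonterminal A h G G') : G'.Sound where
  start := by
    have hh := (hG.rules _ hrm.mem_rules).sound
    obtain ⟨R, -, hs, -⟩ := hrm
    exact hs.sound hh hG.start
  rules q hq := by
    obtain ⟨g, hg, hd⟩ := hrm.exists_derivesAll hq
    exact hd.soundRule (hG.rules _ hrm.mem_rules).sound (hG.rules (q.1, g) hg)
  nodup := (Multiset.nodup_cons.1 (hrm.map_fst ▸ hG.nodup)).2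
  acyclic := by
    obtain ⟨height, hheight⟩ := hG.acyclic
    refine ⟨height, fun q hq B => not_imp_comm.1 fun hB => ?_⟩
    obtain ⟨g, hg, hd⟩ := hrm.exists_derivesAll hq
    refine hd.countLab_eq_zero (not_imp_comm.1 (hheight _ hg B) hB) fun hA => ?_
    exact not_imp_comm.1 (hheight _ hrm.mem_rules B) fun hBA => hB (hBA.trans (hheight _ hg A hA))

lemma RemoveNonterminal.size_le (hG : G.Sound) (hrm : RemoveNonterminal A h G G') :
    (G'.size : ℤ) ≤ G.size + G.con A h := by
  have hA := hrm.mem_rules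
  obtain ⟨R, hR, hs, hrel⟩ := hrm
  set c : ℤ := h.size - handleSize A.rank with hc
  have hsize {g g' : HGraph} (hg : g.Sound) (hd : DerivesAll A h g g') :
      (g'.size : ℤ) ≤ g.size + g.countLab A * c :=
    hd.size_le (hG.rules _ hA) (hG.countLab_self hA) hg
  have hrules : ((G'.rules.map fun p => p.2.size).sum : ℤ) ≤
      (R.map fun p => p.2.size).sum + (R.map fun p => p.2.countLab A).sum * c := by
    have hle : (G'.rules.map fun q => (q.2.size : ℤ)).sum ≤
        (R.map fun p => (p.2.size : ℤ) + p.2.countLab A * c).sum := by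
      refine Multiset.sum_le_sum_of_rel_le <|
        Multiset.rel_map.2 ((Multiset.rel_flip.2 hrel).mono ?_)
      exact fun q _ p hp hpq =>
        hsize (hG.rules p (hR ▸ Multiset.mem_cons_of_mem hp)).sound hpq.2
    rw [Multiset.sum_map_add, Multiset.sum_map_mul_right] at hle
    push_cast [Multiset.map_map, Function.comp_def]
    exact hle
  have hstart := hsize hG.start hs
  have href : G.ref A = G.start.countLab A + (R.map fun p => p.2.countLab A).sum := by
    simp [Grammar.ref, hR, hG.countLab_self hA]
  have hGsize : G.size = G.start.size + (h.size + (R.map fun p => p.2.size).sum) := by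
    simp [Grammar.size, hR]
  rw [Grammar.con, href, hGsize, Grammar.size, ← hc]
  push_cast [Multiset.map_map, Function.comp_def] at hrules ⊢
  linarith

end Remove

section Prune

variable {G G' : Grammar} {l : List Symb}

lemma PruneOnce.sound_and_size_le (hp : PruneOnce G G') (hG : G.Sound) :
    G'.Sound ∧ G'.size ≤ G.size := by
  obtain ⟨hp, -⟩ := hp
  induction hp with
  | refl => exact ⟨hG, le_rfl⟩
  | tail _ hs ih =>
    obtain ⟨A, h, -, href, hrm⟩ := hs
    refine ⟨hrm.sound ih.1, le_trans ?_ ih.2⟩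
    have hsize := hrm.size_le ih.1
    rw [Grammar.con, href] at hsize
    push_cast at hsize
    omega

lemma PruneTraverse.size_le (hp : PruneTraverse l G G') (hG : G.Sound) : G'.size ≤ G.size := by
  induction hp with
  | done => exact le_rfl
  | remove _ hc hrm _ ih =>
    have h₁ := hrm.size_le hG
    have h₂ := ih (hrm.sound hG)
    omega
  | keep _ _ _ ih => exact ih hG

lemma Prune.size_le (hp : Prune G G') (hG : G.Sound) : G'.size ≤ G.size := by
  obtain ⟨G₁, l, hone, -, htrav⟩ := hp
  obtain ⟨hG₁, hsize⟩ := hone.sound_and_size_le hG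
  exact (htrav.size_le hG₁).trans hsize

lemma exists_pruneOnce (hG : G.Sound) : ∃ G', PruneOnce G G' := by
  induction hn : G.rules.card using Nat.strong_induction_on generalizing G with
  | _ n ih =>
    by_cases hc : ∀ p ∈ G.rules, G.ref p.1 ≠ 1
    · exact ⟨G, .refl, hc⟩
    · push Not at hc
      obtain ⟨⟨A, h⟩, hA, href⟩ := hc
      obtain ⟨G₁, hrm⟩ := exists_removeNonterminal hG hA
      obtain ⟨G₂, hsteps, hend⟩ :=
        ih _ (by have := hrm.card_rules; omega) (hrm.sound hG) rfl
      exact ⟨G₂, .head ⟨A, h, hA, href, hrm⟩ hsteps, hend⟩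

lemma exists_pruneTraverse (hG : G.Sound) (hl : l.Nodup)
    (hlG : ∀ A ∈ l, A ∈ G.rules.map Prod.fst) : ∃ G', PruneTraverse l G G' := by
  induction l generalizing G with
  | nil => exact ⟨G, .done G⟩
  | cons A l ih =>
    rw [List.nodup_cons] at hl
    obtain ⟨h, hA⟩ := mem_map_fst.1 (hlG A List.mem_cons_self)
    have hlG' (B : Symb) (hB : B ∈ l) : B ∈ G.rules.map Prod.fst :=
      hlG B (List.mem_cons_of_mem A hB)
    by_cases hc : G.con A h ≤ 0
    · obtain ⟨G₁, hrm⟩ := exists_removeNonterminal hG hA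
      obtain ⟨G₂, hrest⟩ := ih (hrm.sound hG) hl.2 fun B hB =>
        (Multiset.mem_cons.1 (hrm.map_fst ▸ hlG' B hB)).resolve_left (by rintro rfl; exact hl.1 hB)
      exact ⟨G₂, .remove hA hc hrm hrest⟩
    · obtain ⟨G₂, hrest⟩ := ih hG hl.2 hlG'
      exact ⟨G₂, .keep hA (not_le.1 hc) hrest⟩

lemma exists_prune (hG : G.Sound) : ∃ G', Prune G G' := by
  obtain ⟨G₁, hone⟩ := exists_pruneOnce hG
  have hG₁ := (hone.sound_and_size_le hG).1
  obtain ⟨l, hl⟩ := hG₁.exists_isBottomUp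
  obtain ⟨G₂, htrav⟩ := exists_pruneTraverse hG₁ (Multiset.coe_nodup.1 (hl.1 ▸ hG₁.nodup))
    fun A hA => hl.1 ▸ Multiset.mem_coe.2 hA
  exact ⟨G₂, G₁, l, hone, hl, htrav⟩

lemma Prune.eq_of_rules_eq_zero (hp : Prune G G') (hG : G.rules = 0) : G' = G := by
  obtain ⟨G₁, l, hone, hbot, htrav⟩ := hp
  obtain rfl : G = G₁ := by
    rcases Relation.ReflTransGen.cases_head hone.1 with heq | ⟨G₂, ⟨A, h, hA, -⟩, -⟩
    · exact heq
    · simp [hG] at hA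
  obtain rfl : l = [] := by simpa [hG] using hbot.1
  cases htrav
  rfl

end Prune

/-! ### The replacement loop -/

lemma HGraph.IsDigram.card_occEdges {d : HGraph} (hd : d.IsDigram) (φ : ℕ → ℕ) :
    (occEdges d φ).card = 2 := by
  obtain ⟨-, e₁, e₂, hE, -⟩ := hd
  simp [occEdges, hE]

lemma HGraph.IsDigram.exists_mem_att {d : HGraph} (hd : d.IsDigram) {v : ℕ} (hv : v ∈ d.V) :
    ∃ e ∈ d.E, v ∈ e.att := by
  obtain ⟨-, e₁, e₂, hE, hcov, -⟩ := hd
  rcases hcov v hv with h | h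
  · exact ⟨e₁, by simp [hE], h⟩
  · exact ⟨e₂, by simp [hE], h⟩

lemma HGraph.IsDigram.card_sum_occEdges {d : HGraph} (hd : d.IsDigram) (L : List (ℕ → ℕ)) :
    (L.map (occEdges d)).sum.card = 2 * L.length := by
  induction L with
  | nil => rfl
  | cons φ L ih =>
    rw [List.map_cons, List.sum_cons, Multiset.card_add, ih, hd.card_occEdges, List.length_cons]
    ring

lemma IsNonOverlapping.two_mul_length_le {g d : HGraph} {L : List (ℕ → ℕ)}
    (hL : IsNonOverlapping g d L) (hd : d.IsDigram) : 2 * L.length ≤ g.E.card := by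
  rw [← hd.card_sum_occEdges]
  exact Multiset.card_le_card hL.2

lemma occEdges_le_sum (d : HGraph) {L : List (ℕ → ℕ)} {φ : ℕ → ℕ} (hφ : φ ∈ L) :
    occEdges d φ ≤ (L.map (occEdges d)).sum :=
  List.le_sum_of_mem (List.mem_map_of_mem hφ)

lemma occEdges_add_le_sum (d : HGraph) {L : List (ℕ → ℕ)} {φ ψ : ℕ → ℕ} (hφ : φ ∈ L) (hψ : ψ ∈ L)
    (hne : φ ≠ ψ) : occEdges d φ + occEdges d ψ ≤ (L.map (occEdges d)).sum := by
  classical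
  rw [((List.perm_cons_erase hφ).map (occEdges d)).sum_eq, List.map_cons, List.sum_cons]
  gcongr
  exact occEdges_le_sum d ((List.mem_erase_of_ne hne.symm).2 hψ)

lemma IsNonOverlapping.not_mem_att_of_mem_sub {g d : HGraph} {L : List (ℕ → ℕ)}
    (hL : IsNonOverlapping g d L) {φ : ℕ → ℕ} (hφ : φ ∈ L) {u : ℕ} (hu : u ∈ d.V)
    (hue : u ∉ d.ext) {e : Edge} (he : e ∈ g.E - (L.map (occEdges d)).sum) : φ u ∉ e.att :=
  fun hv => hue <| ((hL.1 φ hφ).ext_iff u hu).2 <|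
    .inl ⟨e, Multiset.mem_of_le (tsub_le_tsub_left (occEdges_le_sum d hφ) g.E) he, hv⟩

lemma IsNonOverlapping.ne_of_mem_ext {g d : HGraph} {L : List (ℕ → ℕ)}
    (hL : IsNonOverlapping g d L) (hd : d.IsDigram) {φ ψ : ℕ → ℕ} (hφ : φ ∈ L) (hψ : ψ ∈ L)
    {u w : ℕ} (hu : u ∈ d.V) (hue : u ∉ d.ext) (hw : w ∈ d.ext) : φ u ≠ ψ w := by
  intro heq
  rcases eq_or_ne φ ψ with rfl | hne
  · exact hue ((hL.1 φ hφ).inj hu (hd.1.ext_subset w hw) heq ▸ hw)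
  · obtain ⟨e, he, hwe⟩ := hd.exists_mem_att (hd.1.ext_subset w hw)
    have hle : occEdges d ψ ≤ g.E - occEdges d φ :=
      le_tsub_of_add_le_left ((occEdges_add_le_sum d hφ hψ hne).trans hL.2)
    refine hue <| ((hL.1 φ hφ).ext_iff u hu).2 <|
      .inl ⟨e.rename ψ, Multiset.mem_of_le hle (Multiset.mem_map_of_mem _ he), ?_⟩
    exact heq ▸ List.mem_map_of_mem hwe

lemma IsNonOverlapping.replaceOccs_sound {g d : HGraph} {L : List (ℕ → ℕ)}
    (hL : IsNonOverlapping g d L) (hg : g.Sound) (hd : d.IsDigram) {A : Symb}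
    (hA : A.rank = d.rank) : (replaceOccs g d A L).Sound := by
  have hcases {e : Edge} (he : e ∈ (replaceOccs g d A L).E) :
      e ∈ g.E - (L.map (occEdges d)).sum ∨ ∃ ψ ∈ L, e = ⟨A, d.ext.map ψ⟩ := by
    simpa [replaceOccs, eq_comm] using he
  have hmem {e : Edge} (he : e ∈ g.E - (L.map (occEdges d)).sum) : e ∈ g.E :=
    Multiset.mem_of_le tsub_le_self he
  constructor
  · intro e he v hv
    rw [replaceOccs, Finset.mem_filter]
    rcases hcases he with he | ⟨ψ, hψ, rfl⟩
    · refine ⟨hg.att_subset e (hmem he) v hv, ?_⟩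
      rintro ⟨φ, hφ, u, hu, hue, rfl⟩
      exact hL.not_mem_att_of_mem_sub hφ hu hue he hv
    · obtain ⟨w, hw, rfl⟩ := List.mem_map.1 hv
      obtain ⟨e, he, hwe⟩ := hd.exists_mem_att (hd.1.ext_subset w hw)
      refine ⟨hg.att_subset (e.rename ψ) (Multiset.mem_of_le (hL.1 ψ hψ).edges_le
        (Multiset.mem_map_of_mem _ he)) _ (List.mem_map_of_mem hwe), ?_⟩
      rintro ⟨φ, hφ, u, hu, hue, heq⟩
      exact hL.ne_of_mem_ext hd hφ hψ hu hue hw heq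
  · intro e he
    rcases hcases he with he | ⟨ψ, hψ, rfl⟩
    · exact hg.att_nodup e (hmem he)
    · exact hd.1.ext_nodup.map_on fun x hx y hy =>
        (hL.1 ψ hψ).inj (hd.1.ext_subset x hx) (hd.1.ext_subset y hy)
  · intro e he
    rcases hcases he with he | ⟨ψ, -, rfl⟩
    · exact hg.rank_lab e (hmem he)
    · simp only [Edge.rank, List.length_map, hA, HGraph.rank]

lemma Grammar.IsFresh.countLab_start {G : Grammar} {A : Symb} (hA : G.IsFresh A) :
    G.start.countLab A = 0 :=
  (Nat.add_eq_zero_iff.1 hA.1).1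

lemma Grammar.IsFresh.countLab_rules {G : Grammar} {A : Symb} (hA : G.IsFresh A)
    {p : Symb × HGraph} (hp : p ∈ G.rules) : p.2.countLab A = 0 :=
  Multiset.sum_eq_zero_iff.1 (Nat.add_eq_zero_iff.1 hA.1).2 _ (Multiset.mem_map_of_mem _ hp)

lemma Grammar.exists_isFresh (G : Grammar) (n : ℕ) : ∃ i, G.IsFresh (.nonterm i n) := by
  let M : Multiset Symb := G.start.E.map Edge.lab + G.rules.map Prod.fst +
    G.rules.bind fun p => p.2.E.map Edge.lab
  have hinj : Function.Injective fun i => Symb.nonterm i n := fun i j hij => by simpa using hij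
  obtain ⟨i, hi⟩ := Infinite.exists_notMem_finset (M.toFinset.preimage _ hinj.injOn)
  have hi : Symb.nonterm i n ∉ M := by simpa using hi
  simp only [M, Multiset.mem_add, Multiset.mem_bind, Multiset.mem_map, not_or, not_exists,
    not_and] at hi
  obtain ⟨⟨hstart, hlhs⟩, hrules⟩ := hi
  refine ⟨i, ?_, hlhs⟩
  rw [Grammar.ref, Nat.add_eq_zero_iff, HGraph.countLab_eq_zero, Multiset.sum_eq_zero_iff]
  refine ⟨hstart, fun c hc => ?_⟩
  obtain ⟨p, hp, rfl⟩ := Multiset.mem_map.1 hc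
  exact HGraph.countLab_eq_zero.2 (hrules p hp)

lemma Grammar.Sound.cons_rule {G : Grammar} (hG : G.Sound) {A : Symb} {h : HGraph}
    (hA : G.IsFresh A) (hh : SoundRule A h) (hAh : h.countLab A = 0) :
    Grammar.Sound ⟨G.start, (A, h) ::ₘ G.rules⟩ where
  start := hG.start
  rules := Multiset.forall_mem_cons.2 ⟨hh, hG.rules⟩
  nodup := by
    rw [Multiset.map_cons, Multiset.nodup_cons, Multiset.mem_map]
    exact ⟨fun ⟨p, hp, hpA⟩ => hA.2 p hp hpA, hG.nodup⟩
  acyclic := by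
    obtain ⟨height, hheight⟩ := hG.acyclic
    let N := (h.E.map fun e => height e.lab).sum + 1
    have hne {g : HGraph} (hg : g.countLab A = 0) {B : Symb} (hB : g.countLab B ≠ 0) : B ≠ A :=
      fun hBA => hB (hBA ▸ hg)
    refine ⟨Function.update height A N, Multiset.forall_mem_cons.2 ⟨fun B hB => ?_,
      fun p hp B hB => ?_⟩⟩
    · rw [Function.update_of_ne (hne hAh hB), Function.update_self]
      rw [Ne, HGraph.countLab_eq_zero] at hB
      push Not at hB
      obtain ⟨e, he, rfl⟩ := hB
      exact Nat.lt_succ_of_le (Multiset.le_sum_of_mem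
        (Multiset.mem_map_of_mem (fun e : Edge => height e.lab) he))
    · rw [Function.update_of_ne (hne (hA.countLab_rules hp) hB),
        Function.update_of_ne (hA.2 p hp)]
      exact hheight p hp B hB

section Loop

variable {r : ℕ∞} {g d : HGraph} {G G' : Grammar} {L : List (ℕ → ℕ)}

lemma IsMostFrequent.isActive (h : IsMostFrequent r g d L) (hL : 2 ≤ L.length) :
    IsActive r g d :=
  ⟨h.1, h.2.1, L, h.2.2.1, hL⟩

lemma IsActive.exists_isMostFrequent (h : IsActive r g d) :
    ∃ d L, IsMostFrequent r g d L ∧ 2 ≤ L.length := by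
  obtain ⟨hd, hr, L, hL, hlen⟩ := h
  let s : Set ℕ := {n | ∃ (d : HGraph) (L : List (ℕ → ℕ)), d.IsDigram ∧ (d.rank : ℕ∞) ≤ r ∧
    IsNonOverlapping g d L ∧ L.length = n}
  have hb : BddAbove s := by
    refine ⟨g.E.card, ?_⟩
    rintro n ⟨d, L, hd, -, hL, rfl⟩
    have := hL.two_mul_length_le hd
    omega
  have hs : L.length ∈ s := ⟨d, L, hd, hr, hL, rfl⟩
  obtain ⟨d', L', hd', hr', hL', hlen'⟩ := Nat.sSup_mem ⟨_, hs⟩ hb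
  refine ⟨d', L', ⟨hd', hr', hL', fun d'' L'' hd'' hr'' hL'' => ?_⟩, ?_⟩
  · exact hlen' ▸ le_csSup hb ⟨d'', L'', hd'', hr'', hL'', rfl⟩
  · exact hlen' ▸ hlen.trans (le_csSup hb hs)

lemma LoopStep.card_lt (h : LoopStep r G G') : G'.start.E.card < G.start.E.card := by
  obtain ⟨d, L, i, ⟨hd, -, hL, -⟩, hlen, -, rfl⟩ := h
  have := hL.two_mul_length_le hd
  simp only [replaceOccs, Multiset.card_add, Multiset.card_sub hL.2, hd.card_sum_occEdges,
    Multiset.coe_card, List.length_map]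
  omega

lemma LoopStep.sound (h : LoopStep r G G') (hG : G.Sound) : G'.Sound := by
  obtain ⟨d, L, i, ⟨hd, -, hL, -⟩, hlen, hfresh, rfl⟩ := h
  obtain ⟨φ, hφ⟩ := List.exists_mem_of_length_pos (show 0 < L.length by omega)
  have hself : d.countLab (.nonterm i d.rank) = 0 := HGraph.countLab_eq_zero.2 fun e he =>
    HGraph.countLab_eq_zero.1 hfresh.countLab_start (e.rename φ)
      (Multiset.mem_of_le (hL.1 φ hφ).edges_le (Multiset.mem_map_of_mem _ he))
  exact
    { hG.cons_rule hfresh ⟨hd.1.sound, hd.1.ext_subset, hd.1.ext_nodup, rfl⟩ hself with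
      start := hL.replaceOccs_sound hG.start hd rfl }

lemma LoopResult.sound (h : LoopResult r G G') (hG : G.Sound) : G'.Sound := by
  obtain ⟨h, -⟩ := h
  induction h with
  | refl => exact hG
  | tail _ hs ih => exact hs.sound ih

lemma exists_loopResult (r : ℕ∞) (G : Grammar) : ∃ G', LoopResult r G G' := by
  induction hn : G.start.E.card using Nat.strong_induction_on generalizing G with
  | _ n ih =>
    by_cases h : ∃ d, IsActive r G.start d
    · obtain ⟨d₀, hd₀⟩ := h
      obtain ⟨d, L, hfreq, hlen⟩ := hd₀.exists_isMostFrequent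
      obtain ⟨i, hi⟩ := G.exists_isFresh d.rank
      have hs : LoopStep r G _ := ⟨d, L, i, hfreq, hlen, hi, rfl⟩
      obtain ⟨G', hsteps, hend⟩ := ih _ (hn ▸ hs.card_lt) _ rfl
      exact ⟨G', .head hs hsteps, hend⟩
    · exact ⟨G, .refl, fun d hd => h ⟨d, hd⟩⟩

lemma LoopResult.eq_of_not_isActive (h : LoopResult r G G')
    (hG : ∀ d, ¬ IsActive r G.start d) : G' = G := by
  rcases Relation.ReflTransGen.cases_head h.1 with heq | ⟨G₁, ⟨d, L, i, hf, hlen, -⟩, -⟩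
  · exact heq.symm
  · exact absurd (hf.isActive hlen) (hG d)

end Loop

/-! ### Virtual edges and outputs -/

section Output

variable {r : ℕ∞} {g : HGraph} {G G' : Grammar}

lemma HGraph.addEdges_zero (g : HGraph) : g.addEdges 0 = g := by
  simp [HGraph.addEdges]

lemma ConnectVirtual.eq_of_isConnected (h : ConnectVirtual G G') (hG : G.start.IsConnected) :
    G' = G := by
  obtain ⟨F, -, -, hmin, rfl⟩ := h
  obtain rfl : F = 0 := by
    by_contra hF
    exact hmin 0 (bot_lt_iff_ne_bot.2 hF) (by rwa [HGraph.addEdges_zero])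
  rw [HGraph.addEdges_zero]

lemma exists_connectVirtual (G : Grammar) : ∃ G', ConnectVirtual G G' := by
  let F₀ : Multiset Edge := (G.start.V.offDiag.val.map fun p => ⟨.virt, [p.1, p.2]⟩)
  have hF₀ : (G.start.addEdges F₀).IsConnected := by
    intro u hu v hv
    rcases eq_or_ne u v with rfl | hne
    · exact .refl
    · refine .single ⟨⟨.virt, [u, v]⟩, Multiset.mem_add.2 (.inr ?_), by simp, by simp⟩
      exact Multiset.mem_map.2 ⟨(u, v), Finset.mem_offDiag.2 ⟨hu, hv, hne⟩, rfl⟩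
  obtain ⟨F, ⟨hle, hconn⟩, hmin⟩ := WellFounded.has_min wellFounded_lt
    {F : Multiset Edge | F ≤ F₀ ∧ (G.start.addEdges F).IsConnected} ⟨F₀, le_rfl, hF₀⟩
  refine ⟨_, F, fun e he => ?_, hconn,
    fun F' hF' h => hmin F' ⟨hF'.le.trans hle, h⟩ hF', rfl⟩
  obtain ⟨p, hp, rfl⟩ := Multiset.mem_map.1 (Multiset.mem_of_le hle he)
  obtain ⟨hu, hv, hne⟩ := Finset.mem_offDiag.1 hp
  simp [hu, hv, hne]

lemma ConnectVirtual.sound (h : ConnectVirtual G G') (hG : G.Sound) : G'.Sound := by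
  obtain ⟨F, hF, -, -, rfl⟩ := h
  have hmem {e : Edge} (he : e ∈ (G.start.addEdges F).E) : e ∈ G.start.E ∨ e ∈ F :=
    Multiset.mem_add.1 he
  exact { hG with
    start :=
      { att_subset := fun e he =>
          (hmem he).elim (hG.start.att_subset e) fun he => (hF e he).2.2.2
        att_nodup := fun e he => (hmem he).elim (hG.start.att_nodup e) fun he => (hF e he).2.2.1
        rank_lab := fun e he => (hmem he).elim (hG.start.rank_lab e) fun he => by
          rw [(hF e he).1]
          exact (hF e he).2.1 } }

lemma HGraph.dropVirtual_size_le (g : HGraph) : g.dropVirtual.size ≤ g.size := by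
  obtain ⟨F, hF⟩ :=
    Multiset.le_iff_exists_add.1 (Multiset.filter_le (fun e => e.lab ≠ Symb.virt) g.E)
  refine Nat.add_le_add_left ?_ _
  rw [hF, Multiset.map_add, Multiset.sum_add]
  exact Nat.le_add_right _ _

lemma Grammar.dropVirtual_size_le (G : Grammar) : G.dropVirtual.size ≤ G.size := by
  refine Nat.add_le_add G.start.dropVirtual_size_le ?_
  simp only [Grammar.dropVirtual, Multiset.map_map]
  exact Multiset.sum_map_le_sum_map _ _ fun p _ => p.2.dropVirtual_size_le

lemma HGraph.Sound.exists_isOutput (hg : g.Sound) (r : ℕ∞) : ∃ G, IsOutput r g G := by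
  obtain ⟨G₁, h₁⟩ := exists_loopResult r (Grammar.ofGraph g)
  obtain ⟨G₂, h₂⟩ := exists_connectVirtual G₁
  obtain ⟨G₃, h₃⟩ := exists_loopResult r G₂
  obtain ⟨G₄, h₄⟩ := exists_prune (h₃.sound (h₂.sound (h₁.sound (.ofGraph hg))))
  exact ⟨_, G₁, G₂, G₃, G₄, h₁, h₂, h₃, h₄, rfl⟩

lemma IsOutput.exists_loopResult_size_le (h : IsOutput r g G) (hg : g.Sound)
    (hconn : ∀ G₁, LoopResult r (Grammar.ofGraph g) G₁ → G₁.start.IsConnected) :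
    ∃ G₁, LoopResult r (Grammar.ofGraph g) G₁ ∧ G.size ≤ G₁.size := by
  obtain ⟨G₁, G₂, G₃, G₄, h₁, h₂, h₃, h₄, rfl⟩ := h
  obtain rfl := h₂.eq_of_isConnected (hconn G₁ h₁)
  obtain rfl := h₃.eq_of_not_isActive h₁.2
  exact ⟨_, h₁, G₄.dropVirtual_size_le.trans (h₄.size_le (h₁.sound (.ofGraph hg)))⟩

lemma IsOutput.eq_ofGraph (h : IsOutput r g G) (hconn : g.IsConnected)
    (hvirt : g.countLab .virt = 0) (hact : ∀ d, ¬ IsActive r g d) : G = Grammar.ofGraph g := by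
  obtain ⟨G₁, G₂, G₃, G₄, h₁, h₂, h₃, h₄, rfl⟩ := h
  obtain rfl := h₁.eq_of_not_isActive hact
  obtain rfl := h₂.eq_of_isConnected hconn
  obtain rfl := h₃.eq_of_not_isActive hact
  obtain rfl := h₄.eq_of_rules_eq_zero rfl
  have hdrop : g.dropVirtual = g := by
    rw [HGraph.dropVirtual, Multiset.filter_eq_self.2 (HGraph.countLab_eq_zero.1 hvirt)]
  simp [Grammar.dropVirtual, Grammar.ofGraph, hdrop]

end Output

/-! ### Digrams in thin graphs -/

/-- The number of edges attached to a node, where being external counts as one further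
attachment. -/
def HGraph.deg (g : HGraph) (v : ℕ) : ℕ := g.E.countP (fun e => v ∈ e.att) + g.ext.count v

/-- Every attached node has degree two. In such a graph the internal nodes of an occurring digram
are determined by its edges: they are the nodes which the two edges share. -/
def HGraph.IsThin (g : HGraph) : Prop := ∀ e ∈ g.E, ∀ v ∈ e.att, g.deg v = 2

/-- `d` is a digram with edges `e₁` and `e₂` whose internal nodes are the nodes which these edges
share. Up to the order of its external nodes, `d` is determined by the two edges. -/
structure HGraph.IsThinDigram (d : HGraph) (e₁ e₂ : Edge) : Prop where
  isDigram : d.IsDigram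
  edges : d.E = {e₁, e₂}
  mem_V : ∀ v, v ∈ d.V ↔ v ∈ e₁.att ∨ v ∈ e₂.att
  mem_ext : ∀ v, v ∈ d.ext ↔ v ∈ d.V ∧ ¬ (v ∈ e₁.att ∧ v ∈ e₂.att)

lemma HGraph.IsThinDigram.symm {d : HGraph} {e₁ e₂ : Edge} (h : d.IsThinDigram e₁ e₂) :
    d.IsThinDigram e₂ e₁ where
  isDigram := h.isDigram
  edges := h.edges.trans (Multiset.pair_comm _ _)
  mem_V v := (h.mem_V v).trans or_comm
  mem_ext v := by rw [h.mem_ext, and_comm (a := v ∈ e₁.att)]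

lemma HGraph.exists_isThinDigram {e₁ e₂ : Edge} (h₁ : e₁.att.Nodup) (h₂ : e₂.att.Nodup)
    (hr₁ : e₁.rank = e₁.lab.rank) (hr₂ : e₂.rank = e₂.lab.rank)
    (hshare : ∃ v, v ∈ e₁.att ∧ v ∈ e₂.att) (hne : ∃ v ∈ e₁.att, v ∉ e₂.att) :
    ∃ d : HGraph, d.IsThinDigram e₁ e₂ := by
  let d : HGraph := ⟨(e₁.att ++ e₂.att).toFinset, {e₁, e₂},
    e₁.att.filter (· ∉ e₂.att) ++ e₂.att.filter (· ∉ e₁.att)⟩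
  have hV (v : ℕ) : v ∈ d.V ↔ v ∈ e₁.att ∨ v ∈ e₂.att := by simp [d]
  have hext (v : ℕ) : v ∈ d.ext ↔ v ∈ d.V ∧ ¬ (v ∈ e₁.att ∧ v ∈ e₂.att) := by
    simp only [d, List.mem_append, List.mem_filter, decide_eq_true_eq, List.mem_toFinset]
    tauto
  have hE : ∀ e ∈ d.E, e = e₁ ∨ e = e₂ := by simp [d]
  obtain ⟨c, hc₁, hc₂⟩ := hshare
  obtain ⟨x, hx₁, hx₂⟩ := hne
  refine ⟨d, ⟨⟨⟨⟨c, (hV c).2 (.inl hc₁)⟩, ?_, ?_, ?_, ?_, fun v hv => ((hext v).1 hv).1, ?_⟩,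
    e₁, e₂, rfl, fun v hv => (hV v).1 hv, ⟨c, (hV c).2 (.inl hc₁), hc₁, hc₂⟩, ?_⟩, rfl, hV, hext⟩⟩
  · rintro e he v hv
    rcases hE e he with rfl | rfl
    exacts [(hV v).2 (.inl hv), (hV v).2 (.inr hv)]
  · rintro e he
    rcases hE e he with rfl | rfl <;> assumption
  · rintro e he
    rcases hE e he with rfl | rfl
    exacts [List.ne_nil_of_mem hc₁, List.ne_nil_of_mem hc₂]
  · rintro e he
    rcases hE e he with rfl | rfl <;> assumption
  · refine (h₁.filter _).append (h₂.filter _) fun v hv₁ hv₂ => ?_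
    simp only [List.mem_filter, decide_eq_true_eq] at hv₁ hv₂
    exact hv₁.2 hv₂.1
  · exact List.ne_nil_of_mem ((hext x).2 ⟨(hV x).2 (.inl hx₁), fun h => hx₂ h.2⟩)

section ThinDigram

variable {d : HGraph} {e₁ e₂ : Edge}

lemma HGraph.IsThinDigram.exists_mem_att_and_mem_att (h : d.IsThinDigram e₁ e₂) :
    ∃ v, v ∈ e₁.att ∧ v ∈ e₂.att := by
  obtain ⟨-, f₁, f₂, hf, -, ⟨v, -, hv₁, hv₂⟩, -⟩ := h.isDigram
  have hpair : ({e₁, e₂} : Multiset Edge) = {f₁, f₂} := h.edges ▸ hf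
  rcases Multiset.cons_eq_cons.1 hpair with ⟨rfl, h₂⟩ | ⟨-, s, h₂, h₁⟩
  · exact ⟨v, hv₁, Multiset.singleton_inj.1 h₂ ▸ hv₂⟩
  · obtain ⟨rfl, rfl⟩ := (Multiset.singleton_eq_cons_iff _).1 h₂
    exact ⟨v, Multiset.singleton_inj.1 h₁ ▸ hv₂, hv₁⟩

lemma HGraph.IsThinDigram.V_eq (h : d.IsThinDigram e₁ e₂) :
    d.V = e₁.att.toFinset ∪ e₂.att.toFinset := by
  ext v
  rw [h.mem_V, Finset.mem_union, List.mem_toFinset, List.mem_toFinset]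

lemma HGraph.IsThinDigram.card_V_add (h : d.IsThinDigram e₁ e₂) :
    d.V.card + (e₁.att.toFinset ∩ e₂.att.toFinset).card = e₁.rank + e₂.rank := by
  have hnodup := h.isDigram.1.att_nodup
  simp only [h.edges, Multiset.insert_eq_cons, Multiset.mem_cons, Multiset.mem_singleton,
    forall_eq_or_imp, forall_eq] at hnodup
  rw [h.V_eq, Finset.card_union_add_card_inter, List.toFinset_card_of_nodup hnodup.1,
    List.toFinset_card_of_nodup hnodup.2, Edge.rank, Edge.rank]

lemma HGraph.IsThinDigram.rank_add (h : d.IsThinDigram e₁ e₂) :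
    d.rank + (e₁.att.toFinset ∩ e₂.att.toFinset).card = d.V.card := by
  have hext : d.ext.toFinset = d.V \ (e₁.att.toFinset ∩ e₂.att.toFinset) := by
    ext v
    simp only [List.mem_toFinset, h.mem_ext, Finset.mem_sdiff, Finset.mem_inter]
  rw [HGraph.rank, ← List.toFinset_card_of_nodup h.isDigram.1.ext_nodup, hext]
  refine Finset.card_sdiff_add_card_eq_card ?_
  rw [h.V_eq]
  exact Finset.inter_subset_left.trans Finset.subset_union_left

lemma HGraph.IsThinDigram.size_eq (h : d.IsThinDigram e₁ e₂) :
    d.size = d.V.card + (edgeSize e₁.rank + edgeSize e₂.rank) := by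
  simp [HGraph.size, h.edges]

lemma inter_eq_singleton {c : ℕ} (hc : ∀ v, v ∈ e₁.att ∧ v ∈ e₂.att ↔ v = c) :
    e₁.att.toFinset ∩ e₂.att.toFinset = {c} := by
  ext v
  rw [Finset.mem_inter, List.mem_toFinset, List.mem_toFinset, hc, Finset.mem_singleton]

end ThinDigram

lemma exists_mem_att_or_mem_ext_iff {g d : HGraph} {e₁ e₂ : Edge} {φ : ℕ → ℕ} {v : ℕ}
    (hg : g.IsThin) (hd : d.IsHypergraph) (hE : d.E = {e₁, e₂}) (hv : v ∈ d.V)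
    (hcov : v ∈ e₁.att ∨ v ∈ e₂.att) (hinj : Set.InjOn φ d.V) (hle : occEdges d φ ≤ g.E) :
    ((∃ e ∈ g.E - occEdges d φ, φ v ∈ e.att) ∨ φ v ∈ g.ext) ↔ ¬ (v ∈ e₁.att ∧ v ∈ e₂.att) := by
  have hmem (e : Edge) (he : e ∈ d.E) : φ v ∈ (e.rename φ).att ↔ v ∈ e.att :=
    Edge.mem_att_rename_iff (hd.att_subset e he) hinj hv
  have hmem₁ := hmem e₁ (by simp [hE])
  have hmem₂ := hmem e₂ (by simp [hE])
  have hocc : occEdges d φ = {e₁.rename φ, e₂.rename φ} := by simp [occEdges, hE]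
  have hdeg : g.deg (φ v) = 2 := by
    rcases hcov with h | h
    · exact hg _ (Multiset.mem_of_le hle (by simp [hocc])) _ (hmem₁.2 h)
    · exact hg _ (Multiset.mem_of_le hle (by simp [hocc])) _ (hmem₂.2 h)
  have hrest : (∃ e ∈ g.E - occEdges d φ, φ v ∈ e.att) ∨ φ v ∈ g.ext ↔
      0 < (g.E - occEdges d φ).countP (fun e => φ v ∈ e.att) + g.ext.count (φ v) := by
    rw [Nat.add_pos_iff_pos_or_pos, Multiset.countP_pos, List.count_pos_iff]
  have hocc_count : (occEdges d φ).countP (fun e => φ v ∈ e.att) =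
      (if v ∈ e₁.att then 1 else 0) + (if v ∈ e₂.att then 1 else 0) := by
    rw [hocc, Multiset.insert_eq_cons, ← Multiset.cons_zero, Multiset.countP_cons,
      Multiset.countP_cons, Multiset.countP_zero, zero_add, add_comm]
    simp only [hmem₁, hmem₂]
  have hsum : (g.E - occEdges d φ).countP (fun e => φ v ∈ e.att) + g.ext.count (φ v) +
      ((if v ∈ e₁.att then 1 else 0) + (if v ∈ e₂.att then 1 else 0)) = 2 := by
    rw [← hocc_count, add_right_comm, ← Multiset.countP_add, tsub_add_cancel_of_le hle]
    exact hdeg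
  rw [hrest]
  split_ifs at hsum with h₁ h₂ h₂ <;> simp only [h₁, h₂, and_self, and_true, and_false,
    not_true_eq_false, not_false_eq_true, iff_true, iff_false] <;> omega

lemma IsOccurrence.exists_isThinDigram {g d : HGraph} {φ : ℕ → ℕ} (h : IsOccurrence g d φ)
    (hg : g.IsThin) (hd : d.IsDigram) : ∃ e₁ e₂, d.IsThinDigram e₁ e₂ := by
  obtain ⟨hhyp, e₁, e₂, hE, hcov, -⟩ := id hd
  refine ⟨e₁, e₂, hd, hE, fun v => ⟨hcov v, ?_⟩, fun v => ?_⟩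
  · rintro (hv | hv)
    exacts [hhyp.att_subset e₁ (by simp [hE]) v hv, hhyp.att_subset e₂ (by simp [hE]) v hv]
  · refine ⟨fun hv => ⟨hhyp.ext_subset v hv, ?_⟩, fun ⟨hv, hnot⟩ => ?_⟩
    · have hvV := hhyp.ext_subset v hv
      exact (exists_mem_att_or_mem_ext_iff hg hhyp hE hvV (hcov v hvV) h.inj h.edges_le).1
        ((h.ext_iff v hvV).1 hv)
    · exact (h.ext_iff v hv).2
        ((exists_mem_att_or_mem_ext_iff hg hhyp hE hv (hcov v hv) h.inj h.edges_le).2 hnot)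

lemma HGraph.IsThinDigram.isOccurrence {g d : HGraph} {e₁ e₂ : Edge} {φ : ℕ → ℕ}
    (h : d.IsThinDigram e₁ e₂) (hg : g.IsThin) (hinj : Set.InjOn φ d.V)
    (hle : occEdges d φ ≤ g.E) : IsOccurrence g d φ where
  inj := hinj
  edges_le := hle
  ext_iff v hv := by
    rw [h.mem_ext, and_iff_right hv, exists_mem_att_or_mem_ext_iff hg h.isDigram.1 h.edges hv
      ((h.mem_V v).1 hv) hinj hle]

/-! ### Renaming the nodes of a digram -/

section Rename

variable {g d : HGraph} {φ θ χ ψ : ℕ → ℕ} {L : List (ℕ → ℕ)}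

@[simp] lemma HGraph.rank_rename (ψ : ℕ → ℕ) (g : HGraph) : (g.rename ψ).rank = g.rank := by
  simp [HGraph.rank, HGraph.rename]

lemma HGraph.size_rename (hψ : Set.InjOn ψ g.V) : (g.rename ψ).size = g.size := by
  rw [HGraph.size, HGraph.size, HGraph.rename, sum_edgeSize_map_rename,
    Finset.card_image_of_injOn hψ]

lemma Edge.rename_rename (φ ψ : ℕ → ℕ) (e : Edge) : (e.rename ψ).rename φ = e.rename (φ ∘ ψ) := by
  simp [Edge.rename]

lemma Edge.rename_congr {e : Edge} (h : ∀ v ∈ e.att, φ v = θ v) : e.rename φ = e.rename θ := by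
  rw [Edge.rename, Edge.rename, List.map_congr_left h]

lemma HGraph.rename_rename (φ ψ : ℕ → ℕ) (g : HGraph) :
    (g.rename ψ).rename φ = g.rename (φ ∘ ψ) := by
  simp [HGraph.rename, Finset.image_image, Edge.rename_rename]

lemma HGraph.IsHypergraph.rename_eq_self (hd : d.IsHypergraph) (hψ : ∀ v ∈ d.V, ψ v = v) :
    d.rename ψ = d := by
  have hedge (e : Edge) (he : e ∈ d.E) : e.rename ψ = e := by
    rw [Edge.rename_congr (θ := id) fun v hv => hψ v (hd.att_subset e he v hv), Edge.rename,
      List.map_id]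
  rw [HGraph.rename, Finset.image_congr (g := id) hψ, Finset.image_id,
    Multiset.map_congr rfl hedge, Multiset.map_id',
    List.map_congr_left fun v hv => hψ v (hd.ext_subset v hv), List.map_id']

lemma HGraph.IsHypergraph.exists_rename_rename_eq (hd : d.IsHypergraph) (hψ : Set.InjOn ψ d.V) :
    ∃ χ, Set.InjOn χ (d.rename ψ).V ∧ (d.rename ψ).rename χ = d := by
  have hinv : Set.LeftInvOn (Function.invFunOn ψ d.V) ψ d.V := hψ.leftInvOn_invFunOn
  refine ⟨Function.invFunOn ψ d.V, ?_, ?_⟩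
  · rw [HGraph.rename, Finset.coe_image]
    rintro _ ⟨u, hu, rfl⟩ _ ⟨v, hv, rfl⟩ huv
    rw [← hinv hu, ← hinv hv, huv]
  · rw [HGraph.rename_rename]
    exact hd.rename_eq_self fun v hv => hinv hv

lemma HGraph.IsHypergraph.rename (hd : d.IsHypergraph) (hψ : Set.InjOn ψ d.V) :
    (d.rename ψ).IsHypergraph where
  nonempty := hd.nonempty.image ψ
  att_subset := (hd.sound.rename hψ).att_subset
  att_nodup := (hd.sound.rename hψ).att_nodup
  att_ne_nil := by simpa [HGraph.rename] using hd.att_ne_nil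
  rank_lab := (hd.sound.rename hψ).rank_lab
  ext_subset v hv := by
    obtain ⟨u, hu, rfl⟩ := List.mem_map.1 hv
    exact Finset.mem_image_of_mem _ (hd.ext_subset u hu)
  ext_nodup := hd.ext_nodup.map_on fun x hx y hy => hψ (hd.ext_subset x hx) (hd.ext_subset y hy)

lemma HGraph.IsDigram.rename (hd : d.IsDigram) (hψ : Set.InjOn ψ d.V) :
    (d.rename ψ).IsDigram := by
  obtain ⟨hhyp, e₁, e₂, hE, hcov, ⟨c, hc, hc₁, hc₂⟩, hext⟩ := hd
  refine ⟨hhyp.rename hψ, e₁.rename ψ, e₂.rename ψ, by simp [HGraph.rename, hE], fun v hv => ?_,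
    ⟨ψ c, Finset.mem_image_of_mem _ hc, List.mem_map_of_mem hc₁, List.mem_map_of_mem hc₂⟩,
    by simpa [HGraph.rename] using hext⟩
  obtain ⟨u, hu, rfl⟩ := Finset.mem_image.1 hv
  exact (hcov u hu).imp (fun h => List.mem_map_of_mem h) fun h => List.mem_map_of_mem h

lemma HGraph.IsThinDigram.rename {e₁ e₂ : Edge} (h : d.IsThinDigram e₁ e₂)
    (hψ : Set.InjOn ψ d.V) : (d.rename ψ).IsThinDigram (e₁.rename ψ) (e₂.rename ψ) where
  isDigram := h.isDigram.rename hψ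
  edges := by simp [HGraph.rename, h.edges]
  mem_V v := by
    simp only [HGraph.rename, Finset.mem_image, h.mem_V, Edge.rename_att, List.mem_map,
      or_and_right, exists_or]
  mem_ext v := by
    have hmem₁ {u : ℕ} (hu : u ∈ d.V) := Edge.mem_att_rename_iff (e := e₁) (V := d.V)
      (fun x hx => (h.mem_V x).2 (.inl hx)) hψ hu
    have hmem₂ {u : ℕ} (hu : u ∈ d.V) := Edge.mem_att_rename_iff (e := e₂) (V := d.V)
      (fun x hx => (h.mem_V x).2 (.inr hx)) hψ hu
    simp only [HGraph.rename, List.mem_map, Finset.mem_image]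
    constructor
    · rintro ⟨u, hu, rfl⟩
      obtain ⟨huV, hnot⟩ := (h.mem_ext u).1 hu
      exact ⟨⟨u, huV, rfl⟩, by rwa [hmem₁ huV, hmem₂ huV]⟩
    · rintro ⟨⟨u, huV, rfl⟩, hnot⟩
      exact ⟨u, (h.mem_ext u).2 ⟨huV, by rwa [hmem₁ huV, hmem₂ huV] at hnot⟩, rfl⟩

lemma HGraph.IsHypergraph.occEdges_rename (hd : d.IsHypergraph) (h : Set.EqOn (φ ∘ χ) θ d.V) :
    occEdges (d.rename χ) φ = occEdges d θ := by
  rw [occEdges, HGraph.rename, Multiset.map_map, occEdges]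
  refine Multiset.map_congr rfl fun e he => ?_
  rw [Function.comp_apply, Edge.rename_rename]
  exact Edge.rename_congr fun v hv => h (hd.att_subset e he v hv)

lemma IsOccurrence.of_rename (hd : d.IsHypergraph) (hχ : Set.InjOn χ d.V)
    (h : IsOccurrence g (d.rename χ) φ) (hθ : Set.EqOn (φ ∘ χ) θ d.V) : IsOccurrence g d θ where
  inj := hθ.injOn_iff.1 <| h.inj.comp hχ fun v hv => Finset.mem_image_of_mem χ hv
  edges_le := hd.occEdges_rename hθ ▸ h.edges_le
  ext_iff v hv := by
    have hext : χ v ∈ (d.rename χ).ext ↔ v ∈ d.ext :=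
      Edge.mem_att_rename_iff (e := ⟨.virt, d.ext⟩) hd.ext_subset hχ hv
    rw [← hext, h.ext_iff _ (Finset.mem_image_of_mem χ hv), hd.occEdges_rename hθ, ← hθ hv,
      Function.comp_apply]

variable {F : (ℕ → ℕ) → ℕ → ℕ}

lemma IsNonOverlapping.of_rename (hd : d.IsHypergraph) (hχ : Set.InjOn χ d.V)
    (hF : ∀ φ ∈ L, Set.EqOn (φ ∘ χ) (F φ) d.V) (hL : IsNonOverlapping g (d.rename χ) L) :
    IsNonOverlapping g d (L.map F) := by
  refine ⟨List.forall_mem_map.2 fun φ hφ => (hL.1 φ hφ).of_rename hd hχ (hF φ hφ), ?_⟩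
  rw [List.map_map]
  exact (List.map_congr_left fun φ hφ => hd.occEdges_rename (hF φ hφ)) ▸ hL.2

lemma replaceOccs_rename (hd : d.IsHypergraph) (hχ : Set.InjOn χ d.V)
    (hF : ∀ φ ∈ L, Set.EqOn (φ ∘ χ) (F φ) d.V) (A : Symb) :
    replaceOccs g (d.rename χ) A L = replaceOccs g d A (L.map F) := by
  have hext {v : ℕ} (hv : v ∈ d.V) : χ v ∈ d.ext.map χ ↔ v ∈ d.ext :=
    Edge.mem_att_rename_iff (e := ⟨.virt, d.ext⟩) hd.ext_subset hχ hv
  rw [replaceOccs, replaceOccs, HGraph.mk.injEq]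
  refine ⟨Finset.filter_congr fun v _ => not_congr ?_, ?_, rfl⟩
  · simp only [List.mem_map, exists_exists_and_eq_and, HGraph.rename, Finset.exists_mem_image]
    refine exists_congr fun φ => and_congr_right fun hφ => exists_congr fun u =>
      and_congr_right fun hu => ?_
    rw [← List.mem_map, hext hu, ← hF φ hφ hu, Function.comp_apply]
  · rw [List.map_map, List.map_map, List.map_congr_left fun φ hφ => hd.occEdges_rename (hF φ hφ)]
    congr 2
    refine List.map_congr_left fun φ hφ => ?_
    simp only [HGraph.rename, List.map_map, Function.comp_apply, Edge.mk.injEq, true_and]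
    exact List.map_congr_left fun v hv => hF φ hφ (hd.ext_subset v hv)

lemma IsMostFrequent.of_rename {r : ℕ∞} (hd : d.IsDigram) (hχ : Set.InjOn χ d.V)
    (hF : ∀ φ ∈ L, Set.EqOn (φ ∘ χ) (F φ) d.V) (h : IsMostFrequent r g (d.rename χ) L) :
    IsMostFrequent r g d (L.map F) :=
  ⟨hd, d.rank_rename χ ▸ h.2.1, h.2.2.1.of_rename hd.1 hχ hF, by
    simpa only [List.length_map] using h.2.2.2⟩

end Rename

/-! ### Spine graphs -/

/-- Translation of a node by `t` periods of a spine with period `K`. -/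
def shift (K t v : ℕ) : ℕ := t * K + v

/-- The `t`-th edge of a spine with period `K`. -/
def spineEdge (K : ℕ) (Z : Symb) (π : List ℕ) (t : ℕ) : Edge := (⟨Z, π⟩ : Edge).rename (shift K t)

/-- The edge of an `a`-labelled leaf. -/
def leafEdge (v : ℕ) : Edge := ⟨.term 0 1, [v]⟩

/-- The nodes of a spine with `m` edges. -/
def spineNodes (m K : ℕ) (π : List ℕ) : Finset ℕ :=
  (Finset.range m ×ˢ π.toFinset).image fun p => shift K p.1 p.2

/-- The nodes of a spine other than the first nodes of its edges. -/
def leafNodes (m K : ℕ) (π : List ℕ) : Finset ℕ :=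
  (spineNodes m K π).filter fun v => ∀ t < m, v ≠ shift K t 0

/-- A chain of `m` translates of a `Z`-labelled edge with attachment sequence `π`, consecutive ones
of which share a node, together with an `a`-labelled edge at each node which is not the first node
of an edge of the chain. -/
def spineGraph (m K : ℕ) (Z : Symb) (π : List ℕ) : HGraph where
  V := spineNodes m K π
  E := (Multiset.range m).map (spineEdge K Z π) + (leafNodes m K π).val.map leafEdge
  ext := [0]

/-- The requirements on the parameters of a spine graph. -/
structure IsSpinePattern (K : ℕ) (Z : Symb) (π : List ℕ) : Prop where
  pos : 0 < K
  nodup : π.Nodup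
  zero_mem : 0 ∈ π
  last_mem : K ∈ π
  le_last : ∀ i ∈ π, i ≤ K
  rank_eq : Z.rank = π.length
  ne_leaf : Z ≠ .term 0 1

section Spine

variable {m K : ℕ} {Z : Symb} {π : List ℕ} {t i v : ℕ}

lemma shift_injective (K t : ℕ) : Function.Injective (shift K t) := fun _ _ => Nat.add_left_cancel

lemma shift_last (K t : ℕ) : shift K t K = shift K (t + 1) 0 := by
  simp only [shift, add_one_mul, add_zero]

lemma exists_shift_eq (hK : 0 < K) (v : ℕ) : ∃ t, ∃ i < K, shift K t i = v :=
  ⟨v / K, v % K, Nat.mod_lt v hK, Nat.div_add_mod' v K⟩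

lemma shift_eq_shift_iff {s j : ℕ} (hi : i < K) (hj : j < K) :
    shift K s j = shift K t i ↔ s = t ∧ j = i := by
  refine ⟨fun h => ?_, fun ⟨hs, hj⟩ => by rw [hs, hj]⟩
  have hdiv (t : ℕ) {i : ℕ} (hi : i < K) : shift K t i / K = t := by
    rw [shift, mul_comm, Nat.mul_add_div (i.zero_le.trans_lt hi), Nat.div_eq_of_lt hi, add_zero]
  obtain rfl : s = t := by rw [← hdiv s hj, h, hdiv t hi]
  exact ⟨rfl, shift_injective K s h⟩

lemma mem_leafEdge {w : ℕ} : v ∈ (leafEdge w).att ↔ v = w := List.mem_singleton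

lemma mem_spineNodes : v ∈ spineNodes m K π ↔ ∃ t < m, v ∈ (spineEdge K Z π t).att := by
  simp only [spineNodes, Finset.mem_image, Finset.mem_product, Finset.mem_range, List.mem_toFinset,
    Prod.exists, spineEdge, Edge.rename_att, List.mem_map, and_assoc, exists_and_left]

lemma shift_zero_mem_spineEdge (h : IsSpinePattern K Z π) (t : ℕ) :
    shift K t 0 ∈ (spineEdge K Z π t).att := List.mem_map_of_mem h.zero_mem

lemma shift_mem_spineEdge_iff (h : IsSpinePattern K Z π) (hi : i < K) {s : ℕ} :
    shift K t i ∈ (spineEdge K Z π s).att ↔ (s = t ∧ i ∈ π) ∨ (s + 1 = t ∧ i = 0) := by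
  rw [spineEdge, Edge.rename_att, List.mem_map]
  constructor
  · rintro ⟨j, hj, hji⟩
    rcases (h.le_last j hj).lt_or_eq with hjK | rfl
    · obtain ⟨rfl, rfl⟩ := (shift_eq_shift_iff hi hjK).1 hji
      exact .inl ⟨rfl, hj⟩
    · rw [shift_last, shift_eq_shift_iff hi h.pos] at hji
      exact .inr ⟨hji.1, hji.2.symm⟩
  · rintro (⟨rfl, hi⟩ | ⟨rfl, rfl⟩)
    exacts [⟨i, hi, rfl⟩, ⟨K, h.last_mem, shift_last K s⟩]

lemma shift_mem_spineNodes_iff (h : IsSpinePattern K Z π) (hi : i < K) :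
    shift K t i ∈ spineNodes m K π ↔ (t < m ∧ i ∈ π) ∨ (0 < t ∧ t ≤ m ∧ i = 0) := by
  simp only [mem_spineNodes (Z := Z), shift_mem_spineEdge_iff h hi]
  constructor
  · rintro ⟨s, hs, ⟨rfl, hiπ⟩ | ⟨rfl, rfl⟩⟩
    exacts [.inl ⟨hs, hiπ⟩, .inr ⟨s.succ_pos, hs, rfl⟩]
  · rintro (⟨ht, hiπ⟩ | ⟨ht, htm, rfl⟩)
    exacts [⟨t, ht, .inl ⟨rfl, hiπ⟩⟩, ⟨t - 1, by lia, .inr ⟨by lia, rfl⟩⟩]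

lemma shift_mem_leafNodes_iff (h : IsSpinePattern K Z π) (hi : i < K) :
    shift K t i ∈ leafNodes m K π ↔ (t < m ∧ i ∈ π ∧ i ≠ 0) ∨ (0 < t ∧ t = m ∧ i = 0) := by
  have hfirst : (∀ s < m, shift K t i ≠ shift K s 0) ↔ ¬ (t < m ∧ i = 0) := by
    simp only [ne_eq, shift_eq_shift_iff h.pos hi]
    exact ⟨fun H ⟨ht, hi⟩ => H t ht ⟨rfl, hi⟩, fun H s hs ⟨hst, hi⟩ => H ⟨hst ▸ hs, hi⟩⟩
  rw [leafNodes, Finset.mem_filter, shift_mem_spineNodes_iff h hi, hfirst]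
  lia

lemma mem_spineGraph_E {e : Edge} :
    e ∈ (spineGraph m K Z π).E ↔
      (∃ t < m, e = spineEdge K Z π t) ∨ ∃ v ∈ leafNodes m K π, e = leafEdge v := by
  simp only [spineGraph, Multiset.mem_add, Multiset.mem_map, Multiset.mem_range, Finset.mem_val,
    eq_comm]

lemma mem_spineNodes_of_mem_att {e : Edge} (he : e ∈ (spineGraph m K Z π).E) (hv : v ∈ e.att) :
    v ∈ spineNodes m K π := by
  rcases mem_spineGraph_E.1 he with ⟨t, ht, rfl⟩ | ⟨w, hw, rfl⟩
  · exact mem_spineNodes.2 ⟨t, ht, hv⟩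
  · rw [mem_leafEdge.1 hv]
    exact Finset.mem_of_mem_filter w hw

lemma spineEdge_injective (h : IsSpinePattern K Z π) : Function.Injective (spineEdge K Z π) := by
  intro s t hst
  have hs := (shift_mem_spineEdge_iff h h.pos).1 (hst ▸ shift_zero_mem_spineEdge h s)
  have ht := (shift_mem_spineEdge_iff h h.pos).1 (hst ▸ shift_zero_mem_spineEdge h t)
  lia

lemma leafEdge_injective : Function.Injective leafEdge := fun v w h => by
  simpa only [leafEdge, Edge.mk.injEq, true_and, List.cons.injEq, and_true] using h

lemma map_spineEdge_add_map_leafEdge_le_iff (h : IsSpinePattern K Z π) {T U : Multiset ℕ} :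
    T.map (spineEdge K Z π) + U.map leafEdge ≤ (spineGraph m K Z π).E ↔
      T ≤ Multiset.range m ∧ U ≤ (leafNodes m K π).val := by
  have hspine (T U : Multiset ℕ) : (T.map (spineEdge K Z π) + U.map leafEdge).filter
      (fun e => e.lab = Z) = T.map (spineEdge K Z π) := by
    rw [Multiset.filter_add, Multiset.filter_eq_self.2, Multiset.filter_eq_nil.2, add_zero]
    · exact Multiset.forall_mem_map_iff.2 fun _ _ => h.ne_leaf.symm
    · exact Multiset.forall_mem_map_iff.2 fun _ _ => rfl
  have hleaf (T U : Multiset ℕ) : (T.map (spineEdge K Z π) + U.map leafEdge).filter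
      (fun e => e.lab ≠ Z) = U.map leafEdge := by
    rw [Multiset.filter_add, Multiset.filter_eq_nil.2, Multiset.filter_eq_self.2, zero_add]
    · exact Multiset.forall_mem_map_iff.2 fun _ _ => h.ne_leaf.symm
    · exact Multiset.forall_mem_map_iff.2 fun _ _ => not_not_intro rfl
  refine ⟨fun hle => ⟨?_, ?_⟩, fun ⟨hT, hU⟩ =>
    add_le_add (Multiset.map_le_map hT) (Multiset.map_le_map hU)⟩
  · rw [← Multiset.map_le_map_iff (spineEdge_injective h), ← hspine T U,
      ← hspine (.range m) (leafNodes m K π).val]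
    exact Multiset.filter_le_filter _ hle
  · rw [← Multiset.map_le_map_iff leafEdge_injective, ← hleaf T U,
      ← hleaf (.range m) (leafNodes m K π).val]
    exact Multiset.filter_le_filter _ hle

lemma countP_mem_spineEdge (h : IsSpinePattern K Z π) (hi : i < K) :
    ((Multiset.range m).map (spineEdge K Z π)).countP (fun e => shift K t i ∈ e.att) =
      (if t < m ∧ i ∈ π then 1 else 0) + if 0 < t ∧ t ≤ m ∧ i = 0 then 1 else 0 := by
  have hcount : ((Multiset.range m).map (spineEdge K Z π)).countP (fun e => shift K t i ∈ e.att) =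
      ((Finset.range m).filter fun s => (s = t ∧ i ∈ π) ∨ (s + 1 = t ∧ i = 0)).card := by
    simp only [Multiset.countP_map, shift_mem_spineEdge_iff h hi]
    rfl
  have hfirst : (Finset.range m).filter (fun s => s = t ∧ i ∈ π) =
      if t < m ∧ i ∈ π then {t} else ∅ := by
    ext s
    split_ifs <;> simp <;> lia
  have hlast : (Finset.range m).filter (fun s => s + 1 = t ∧ i = 0) =
      if 0 < t ∧ t ≤ m ∧ i = 0 then {t - 1} else ∅ := by
    ext s
    split_ifs <;> simp <;> lia
  rw [hcount, Finset.filter_or, Finset.card_union_of_disjoint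
    (Finset.disjoint_filter.2 fun s _ hs => by lia), hfirst, hlast, apply_ite Finset.card,
    apply_ite Finset.card, Finset.card_singleton, Finset.card_singleton, Finset.card_empty]

lemma countP_mem_leafEdge (s : Finset ℕ) (v : ℕ) :
    (s.val.map leafEdge).countP (fun e => v ∈ e.att) = if v ∈ s then 1 else 0 := by
  simp only [Multiset.countP_map, mem_leafEdge]
  rw [← Multiset.countP_eq_card_filter]
  exact Multiset.count_eq_of_nodup s.nodup

lemma spineGraph_isThin (h : IsSpinePattern K Z π) : (spineGraph m K Z π).IsThin := by
  intro e he v hv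
  replace hv := mem_spineNodes_of_mem_att he hv
  obtain ⟨t, i, hi, rfl⟩ := exists_shift_eq h.pos v
  rw [shift_mem_spineNodes_iff h hi] at hv
  have hext : [0].count (shift K t i) = if t = 0 ∧ i = 0 then 1 else 0 := by
    simp [List.count_singleton, shift, h.pos.ne', eq_comm (a := 0)]
  have hzero : i = 0 → i ∈ π := fun hi => hi ▸ h.zero_mem
  rw [HGraph.deg, spineGraph, Multiset.countP_add, countP_mem_spineEdge h hi, countP_mem_leafEdge,
    hext]
  simp only [shift_mem_leafNodes_iff h hi]
  split_ifs <;> lia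

lemma spineGraph_sound (h : IsSpinePattern K Z π) : (spineGraph m K Z π).Sound where
  att_subset _ he _ hv := mem_spineNodes_of_mem_att he hv
  att_nodup e he := by
    rcases mem_spineGraph_E.1 he with ⟨t, -, rfl⟩ | ⟨v, -, rfl⟩
    exacts [h.nodup.map (shift_injective K t), List.nodup_singleton v]
  rank_lab e he := by
    rcases mem_spineGraph_E.1 he with ⟨t, -, rfl⟩ | ⟨v, -, rfl⟩
    exacts [(Edge.rename_rank _ _).trans h.rank_eq.symm, rfl]

lemma spineGraph_isConnected (h : IsSpinePattern K Z π) : (spineGraph m K Z π).IsConnected := by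
  set R := fun x y => ∃ e ∈ (spineGraph m K Z π).E, x ∈ e.att ∧ y ∈ e.att
  have hR {t x y : ℕ} (ht : t < m) (hx : x ∈ (spineEdge K Z π t).att)
      (hy : y ∈ (spineEdge K Z π t).att) : R x y :=
    ⟨_, mem_spineGraph_E.2 (.inl ⟨t, ht, rfl⟩), hx, hy⟩
  have hsymm : Std.Symm R := ⟨fun x y ⟨e, he, hx, hy⟩ => ⟨e, he, hy, hx⟩⟩
  have hfirst (t : ℕ) (ht : t < m) : Relation.ReflTransGen R (shift K 0 0) (shift K t 0) := by
    induction t with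
    | zero => exact .refl
    | succ t ih =>
      refine (ih (by lia)).tail (hR (t := t) (by lia) (shift_zero_mem_spineEdge h t) ?_)
      exact (shift_mem_spineEdge_iff h h.pos).2 (.inr ⟨rfl, rfl⟩)
  have hroot (v : ℕ) (hv : v ∈ spineNodes m K π) : Relation.ReflTransGen R (shift K 0 0) v := by
    obtain ⟨t, ht, hv⟩ := mem_spineNodes.1 hv
    exact (hfirst t ht).tail (hR ht (shift_zero_mem_spineEdge h t) hv)
  exact fun u hu v hv => (Relation.ReflTransGen.stdSymm.symm _ _ (hroot u hu)).trans (hroot v hv)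

lemma edgeSize_le (n : ℕ) : edgeSize n ≤ n + 1 := by
  unfold edgeSize
  split_ifs <;> lia

lemma spineGraph_size_le (m K : ℕ) (Z : Symb) (π : List ℕ) :
    (spineGraph m K Z π).size ≤ m * (3 * π.length + 1) := by
  have hV : (spineNodes m K π).card ≤ m * π.length := by
    refine Finset.card_image_le.trans ?_
    rw [Finset.card_product, Finset.card_range]
    exact Nat.mul_le_mul_left _ (List.toFinset_card_le π)
  have hleaf : (leafNodes m K π).card ≤ m * π.length := (Finset.card_filter_le _ _).trans hV
  have hedge : m * edgeSize π.length ≤ m * (π.length + 1) :=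
    Nat.mul_le_mul_left m (edgeSize_le π.length)
  have hE : ((spineGraph m K Z π).E.map fun e => edgeSize e.rank).sum =
      m * edgeSize π.length + (leafNodes m K π).card := by
    rw [spineGraph, Multiset.map_add, Multiset.sum_add]
    simp [spineEdge, leafEdge, Edge.rank, edgeSize]
  rw [HGraph.size, hE, spineGraph]
  linarith

end Spine

/-! ### Digrams in spine graphs -/

/-- Up to translation, `f` is one of the edges which share a node with an edge of the spine: the
edge of a leaf or the next edge of the spine. -/
def IsSpinePartner (K : ℕ) (Z : Symb) (π : List ℕ) (f : Edge) : Prop :=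
  (∃ i ∈ π, i ≠ 0 ∧ f = leafEdge i) ∨ f = spineEdge K Z π 1

section SpineDigram

variable {d : HGraph} {e₁ e₂ f : Edge} {m K i : ℕ} {Z : Symb} {π : List ℕ} {φ : ℕ → ℕ}

lemma HGraph.IsThinDigram.exists_rename_eq {s : ℕ → ℕ} (hd : d.IsHypergraph) (hs : s.Injective)
    (hφ : Set.InjOn φ d.V) (h : (d.rename φ).IsThinDigram (e₁.rename s) (e₂.rename s)) :
    ∃ d' : HGraph, ∃ χ, Set.InjOn χ d'.V ∧ d'.rename χ = d ∧ d'.IsThinDigram e₁ e₂ := by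
  have hinv : Function.LeftInverse s.invFun s := Function.leftInverse_invFun hs
  have hrange (v : ℕ) (hv : v ∈ (d.rename φ).V) : ∃ u, s u = v := by
    rcases (h.mem_V v).1 hv with hv | hv <;> obtain ⟨u, -, rfl⟩ := List.mem_map.1 hv <;>
      exact ⟨u, rfl⟩
  have hinj : Set.InjOn s.invFun (d.rename φ).V := by
    intro v hv w hw hvw
    obtain ⟨v, rfl⟩ := hrange v hv
    obtain ⟨w, rfl⟩ := hrange w hw
    rw [← hinv v, ← hinv w, hvw]
  have hedge (e : Edge) : (e.rename s).rename s.invFun = e := by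
    rw [Edge.rename_rename, hinv.comp_eq_id, Edge.rename, List.map_id]
  have hthin := h.rename hinj
  rw [hedge, hedge, HGraph.rename_rename] at hthin
  have hcomp : Set.InjOn (s.invFun ∘ φ) d.V :=
    hinj.comp hφ fun v hv => Finset.mem_image_of_mem φ hv
  obtain ⟨χ, hχ, hd'⟩ := hd.exists_rename_rename_eq hcomp
  exact ⟨d.rename (s.invFun ∘ φ), χ, hχ, hd', hthin⟩

lemma spineEdge_succ (K : ℕ) (Z : Symb) (π : List ℕ) (t : ℕ) :
    spineEdge K Z π (t + 1) = (spineEdge K Z π 1).rename (shift K t) := by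
  rw [spineEdge, spineEdge, Edge.rename_rename]
  exact Edge.rename_congr fun v _ => by simp only [shift, Function.comp_apply]; ring

lemma nodup_spineGraph_E (h : IsSpinePattern K Z π) : (spineGraph m K Z π).E.Nodup := by
  refine Multiset.nodup_add.2 ⟨(Multiset.nodup_range m).map (spineEdge_injective h),
    (leafNodes m K π).nodup.map leafEdge_injective, Multiset.disjoint_left.2 fun he he' => ?_⟩
  obtain ⟨t, -, rfl⟩ := Multiset.mem_map.1 he
  obtain ⟨v, -, hv⟩ := Multiset.mem_map.1 he'
  exact h.ne_leaf (congrArg Edge.lab hv).symm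

lemma exists_isSpinePartner (h : IsSpinePattern K Z π) (hd : d.IsThinDigram e₁ e₂)
    (hle : d.E ≤ (spineGraph m K Z π).E) :
    ∃ t f, IsSpinePartner K Z π f ∧ d.IsThinDigram (spineEdge K Z π t) (f.rename (shift K t)) := by
  have hleaf {t v c : ℕ} (ht : t < m) (hv : v ∈ leafNodes m K π)
      (hct : c ∈ (spineEdge K Z π t).att) (hcv : c ∈ (leafEdge v).att) :
      ∃ f, IsSpinePartner K Z π f ∧ f.rename (shift K t) = leafEdge v := by
    obtain ⟨i, hi, rfl⟩ := List.mem_map.1 (mem_leafEdge.1 hcv ▸ hct)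
    refine ⟨leafEdge i, .inl ⟨i, hi, fun hi0 => ?_, rfl⟩, rfl⟩
    exact (Finset.mem_filter.1 hv).2 t ht (hi0 ▸ rfl)
  have hne : e₁ ≠ e₂ := by
    have hnodup := Multiset.nodup_of_le hle (nodup_spineGraph_E h)
    rw [hd.edges] at hnodup
    simpa using hnodup
  obtain ⟨c, hc₁, hc₂⟩ := hd.exists_mem_att_and_mem_att
  rcases mem_spineGraph_E.1 (Multiset.mem_of_le hle (by simp [hd.edges] : e₁ ∈ d.E)) with
    ⟨s, hs, rfl⟩ | ⟨v, hv, rfl⟩ <;>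
  rcases mem_spineGraph_E.1 (Multiset.mem_of_le hle (by simp [hd.edges] : e₂ ∈ d.E)) with
    ⟨t, ht, rfl⟩ | ⟨w, hw, rfl⟩
  · obtain ⟨u, i, hi, rfl⟩ := exists_shift_eq h.pos c
    rw [shift_mem_spineEdge_iff h hi] at hc₁ hc₂
    have hst : s ≠ t := fun hst => hne (hst ▸ rfl)
    obtain rfl | rfl : t = s + 1 ∨ s = t + 1 := by lia
    exacts [⟨s, _, .inr rfl, spineEdge_succ K Z π s ▸ hd⟩,
      ⟨t, _, .inr rfl, spineEdge_succ K Z π t ▸ hd.symm⟩]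
  · obtain ⟨f, hf, hfw⟩ := hleaf hs hw hc₁ hc₂
    exact ⟨s, f, hf, hfw ▸ hd⟩
  · obtain ⟨f, hf, hfv⟩ := hleaf ht hv hc₂ hc₁
    exact ⟨t, f, hf, hfv ▸ hd.symm⟩
  · exact absurd ((mem_leafEdge.1 hc₁).symm.trans (mem_leafEdge.1 hc₂) ▸ rfl) hne

lemma exists_forall_eq_shift_of_mem (h : IsSpinePattern K Z π)
    (hmem : (⟨Z, π⟩ : Edge).rename φ ∈ (spineGraph m K Z π).E) :
    ∃ t, ∀ i ∈ π, φ i = shift K t i := by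
  rcases mem_spineGraph_E.1 hmem with ⟨t, -, ht⟩ | ⟨v, -, hv⟩
  · exact ⟨t, List.map_inj_left.1 (congrArg Edge.att ht)⟩
  · exact absurd (congrArg Edge.lab hv) h.ne_leaf

lemma IsOccurrence.exists_eqOn_shift (h : IsSpinePattern K Z π) (hf : IsSpinePartner K Z π f)
    (hd : d.IsThinDigram ⟨Z, π⟩ f) (hφ : IsOccurrence (spineGraph m K Z π) d φ) :
    ∃ t, Set.EqOn φ (shift K t) d.V := by
  have hmem (e : Edge) (he : e ∈ d.E) : e.rename φ ∈ (spineGraph m K Z π).E :=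
    Multiset.mem_of_le hφ.edges_le (Multiset.mem_map_of_mem _ he)
  obtain ⟨t, ht⟩ := exists_forall_eq_shift_of_mem h (hmem ⟨Z, π⟩ (by simp [hd.edges]))
  refine ⟨t, fun v hv => ?_⟩
  rcases (hd.mem_V v).1 hv with hv | hv
  · exact ht v hv
  rcases hf with ⟨i, hi, -, rfl⟩ | rfl
  · exact ht v (mem_leafEdge.1 hv ▸ hi)
  · have hnext := hmem (spineEdge K Z π 1) (by simp [hd.edges])
    rw [spineEdge, Edge.rename_rename] at hnext
    obtain ⟨s, hs⟩ := exists_forall_eq_shift_of_mem h hnext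
    have hst : shift K s 0 = shift K (t + 1) 0 := by
      rw [← hs 0 h.zero_mem, ← shift_last, ← ht K h.last_mem]
      simp [shift]
    obtain ⟨rfl, -⟩ := (shift_eq_shift_iff h.pos h.pos).1 hst
    obtain ⟨i, hi, rfl⟩ := List.mem_map.1 hv
    refine (hs i hi).trans ?_
    simp only [shift]
    ring

lemma IsMostFrequent.exists_map_shift {r : ℕ∞} {L : List (ℕ → ℕ)} (h : IsSpinePattern K Z π)
    (hd : IsMostFrequent r (spineGraph m K Z π) d L) (hL : 0 < L.length) :
    ∃ (d' : HGraph) (f : Edge) (T : List ℕ), IsSpinePartner K Z π f ∧ d'.IsThinDigram ⟨Z, π⟩ f ∧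
      IsMostFrequent r (spineGraph m K Z π) d' (T.map (shift K)) ∧ T.length = L.length ∧
      d.rank = d'.rank ∧ d.size = d'.size ∧ ∀ A, replaceOccs (spineGraph m K Z π) d A L =
        replaceOccs (spineGraph m K Z π) d' A (T.map (shift K)) := by
  obtain ⟨φ, hφL⟩ := List.exists_mem_of_length_pos hL
  have hφ := hd.2.2.1.1 φ hφL
  obtain ⟨e₁, e₂, hthin⟩ := hφ.exists_isThinDigram (spineGraph_isThin h) hd.1
  obtain ⟨t, f, hf, hthin⟩ := exists_isSpinePartner h (hthin.rename hφ.inj) hφ.edges_le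
  obtain ⟨d', χ, hχ, rfl, hd'⟩ := hthin.exists_rename_eq hd.1.1 (shift_injective K t) hφ.inj
  have hshift (φ : ℕ → ℕ) (hφ : φ ∈ L) : ∃ t, Set.EqOn (φ ∘ χ) (shift K t) d'.V :=
    ((hd.2.2.1.1 φ hφ).of_rename hd'.isDigram.1 hχ (Set.eqOn_refl _ _)).exists_eqOn_shift h hf hd'
  choose! τ hτ using hshift
  refine ⟨d', f, L.map τ, hf, hd', ?_, List.length_map τ, d'.rank_rename χ, HGraph.size_rename hχ,
    fun A => ?_⟩
  · rw [List.map_map]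
    exact hd.of_rename hd'.isDigram hχ hτ
  · rw [List.map_map]
    exact replaceOccs_rename hd'.isDigram.1 hχ hτ A

lemma sum_occEdges_map_shift (hE : d.E = {e₁, e₂}) (K : ℕ) (T : List ℕ) :
    ((T.map (shift K)).map (occEdges d)).sum =
      (T : Multiset ℕ).map (fun t => e₁.rename (shift K t)) +
        (T : Multiset ℕ).map (fun t => e₂.rename (shift K t)) := by
  have hocc (φ : ℕ → ℕ) : occEdges d φ = {e₁.rename φ} + {e₂.rename φ} := by
    rw [occEdges, hE, Multiset.insert_eq_cons, Multiset.map_cons, Multiset.map_singleton,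
      Multiset.singleton_add]
  induction T with
  | nil => rfl
  | cons t T ih =>
    rw [List.map_cons, List.map_cons, List.sum_cons, ih, hocc, ← Multiset.cons_coe,
      Multiset.map_cons, Multiset.map_cons, ← Multiset.singleton_add (e₁.rename _),
      ← Multiset.singleton_add (e₂.rename _), add_add_add_comm]

lemma replaceOccs_map_shift {c : ℕ} (hd : d.IsThinDigram e₁ e₂)
    (hc : ∀ v, v ∈ e₁.att ∧ v ∈ e₂.att ↔ v = c) (g : HGraph) (A : Symb) (K : ℕ) (T : List ℕ) :
    replaceOccs g d A (T.map (shift K)) =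
      ⟨g.V.filter fun v => ∀ t ∈ T, v ≠ shift K t c,
        g.E - ((T : Multiset ℕ).map (fun t => e₁.rename (shift K t)) +
          (T : Multiset ℕ).map (fun t => e₂.rename (shift K t))) +
          (T : Multiset ℕ).map (spineEdge K A d.ext), g.ext⟩ := by
  have hc_mem : c ∈ d.V := (hd.mem_V c).2 (.inl ((hc c).2 rfl).1)
  have hshared (u : ℕ) (hu : u ∈ d.V) : u ∉ d.ext ↔ u = c := by
    rw [hd.mem_ext, and_iff_right hu, not_not, hc]
  have hremoved (v : ℕ) :
      (∃ φ ∈ T.map (shift K), ∃ u ∈ d.V, u ∉ d.ext ∧ φ u = v) ↔ ∃ t ∈ T, v = shift K t c := by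
    simp only [List.mem_map, exists_exists_and_eq_and]
    refine exists_congr fun t => and_congr_right fun _ => ⟨?_, ?_⟩
    · rintro ⟨u, hu, hue, rfl⟩
      rw [(hshared u hu).1 hue]
    · rintro rfl
      exact ⟨c, hc_mem, (hshared c hc_mem).2 rfl, rfl⟩
  rw [replaceOccs, HGraph.mk.injEq, sum_occEdges_map_shift hd.edges]
  refine ⟨Finset.filter_congr fun v _ => ?_, ?_, rfl⟩
  · simp only [hremoved, not_exists, not_and, ne_eq]
  · rw [List.map_map, Multiset.map_coe]
    rfl

lemma isNonOverlapping_map_shift_iff (h : IsSpinePattern K Z π) (hd : d.IsThinDigram ⟨Z, π⟩ f)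
    {T : List ℕ} : IsNonOverlapping (spineGraph m K Z π) d (T.map (shift K)) ↔
      (T : Multiset ℕ).map (spineEdge K Z π) +
        (T : Multiset ℕ).map (fun t => f.rename (shift K t)) ≤ (spineGraph m K Z π).E := by
  refine (and_iff_right_of_imp fun hle => ?_).trans (sum_occEdges_map_shift hd.edges K T ▸ Iff.rfl)
  refine List.forall_mem_map.2 fun t ht => ?_
  exact hd.isOccurrence (spineGraph_isThin h) (shift_injective K t).injOn
    ((occEdges_le_sum d (List.mem_map_of_mem ht)).trans hle)

lemma isNonOverlapping_map_shift_leaf_iff (h : IsSpinePattern K Z π)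
    (hd : d.IsThinDigram ⟨Z, π⟩ (leafEdge i)) {T : List ℕ} :
    IsNonOverlapping (spineGraph m K Z π) d (T.map (shift K)) ↔
      (T : Multiset ℕ) ≤ .range m ∧
        (T : Multiset ℕ).map (fun t => shift K t i) ≤ (leafNodes m K π).val := by
  rw [isNonOverlapping_map_shift_iff h hd, ← map_spineEdge_add_map_leafEdge_le_iff h,
    Multiset.map_map]
  rfl

lemma isNonOverlapping_map_shift_next_iff (h : IsSpinePattern K Z π)
    (hd : d.IsThinDigram ⟨Z, π⟩ (spineEdge K Z π 1)) {T : List ℕ} :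
    IsNonOverlapping (spineGraph m K Z π) d (T.map (shift K)) ↔
      (T : Multiset ℕ) + (T : Multiset ℕ).map Nat.succ ≤ .range m := by
  have hiff := map_spineEdge_add_map_leafEdge_le_iff (m := m) h
    (T := (T : Multiset ℕ) + (T : Multiset ℕ).map Nat.succ) (U := 0)
  rw [Multiset.map_zero, add_zero, and_iff_left (Multiset.zero_le _)] at hiff
  rw [isNonOverlapping_map_shift_iff h hd, ← hiff, Multiset.map_add, Multiset.map_map]
  simp only [← spineEdge_succ, Function.comp_def]

end SpineDigram

/-! ### Replacement in spine graphs -/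

section Replacement

variable {d : HGraph} {e₁ e₂ : Edge} {m s c K i v : ℕ} {A Z : Symb} {π : List ℕ} {T : List ℕ}

lemma HGraph.IsThinDigram.rank_add_two (hd : d.IsThinDigram e₁ e₂)
    (hc : ∀ v, v ∈ e₁.att ∧ v ∈ e₂.att ↔ v = c) : d.rank + 2 = e₁.rank + e₂.rank := by
  have hV := hd.card_V_add
  have hrank := hd.rank_add
  rw [inter_eq_singleton hc, Finset.card_singleton] at hV hrank
  lia

lemma HGraph.IsThinDigram.size_add_one (hd : d.IsThinDigram e₁ e₂)
    (hc : ∀ v, v ∈ e₁.att ∧ v ∈ e₂.att ↔ v = c) :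
    d.size + 1 = e₁.rank + e₂.rank + (edgeSize e₁.rank + edgeSize e₂.rank) := by
  have hV := hd.card_V_add
  rw [inter_eq_singleton hc, Finset.card_singleton] at hV
  rw [hd.size_eq, add_right_comm, hV]

lemma IsSpinePattern.pair_subset (h : IsSpinePattern K Z π) : {0, K} ⊆ π.toFinset := by
  simp [Finset.insert_subset_iff, h.zero_mem, h.last_mem]

lemma IsSpinePattern.two_le_length (h : IsSpinePattern K Z π) : 2 ≤ π.length := by
  rw [← List.toFinset_card_of_nodup h.nodup, ← Finset.card_pair h.pos.ne]
  exact Finset.card_le_card h.pair_subset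

lemma IsSpinePattern.mem_iff_of_length_eq_two (h : IsSpinePattern K Z π) (hπ : π.length = 2) :
    v ∈ π ↔ v = 0 ∨ v = K := by
  have hpair : {0, K} = π.toFinset := Finset.eq_of_subset_of_card_le h.pair_subset <| by
    rw [List.toFinset_card_of_nodup h.nodup, Finset.card_pair h.pos.ne, hπ]
  rw [← List.mem_toFinset, ← hpair, Finset.mem_insert, Finset.mem_singleton]

lemma IsSpinePattern.exists_interior (h : IsSpinePattern K Z π) (hπ : 2 < π.length) :
    ∃ i ∈ π, i ≠ 0 ∧ i ≠ K := by
  have hcard : ({0, K} : Finset ℕ).card < π.toFinset.card := by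
    rwa [List.toFinset_card_of_nodup h.nodup, Finset.card_pair h.pos.ne]
  obtain ⟨i, hi, hi'⟩ := Finset.exists_mem_notMem_of_card_lt_card hcard
  simp only [Finset.mem_insert, Finset.mem_singleton, not_or] at hi'
  exact ⟨i, List.mem_toFinset.1 hi, hi'⟩

lemma mem_att_and_mem_leafEdge_iff (hi : i ∈ π) :
    v ∈ (⟨Z, π⟩ : Edge).att ∧ v ∈ (leafEdge i).att ↔ v = i := by
  rw [mem_leafEdge]
  exact and_iff_right_of_imp fun hv => hv ▸ hi

lemma mem_spineEdge_one : v ∈ (spineEdge K Z π 1).att ↔ ∃ i ∈ π, K + i = v := by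
  simp only [spineEdge, Edge.rename_att, List.mem_map, shift, one_mul]

lemma mem_att_and_mem_spineEdge_one_iff (h : IsSpinePattern K Z π) :
    v ∈ (⟨Z, π⟩ : Edge).att ∧ v ∈ (spineEdge K Z π 1).att ↔ v = K := by
  rw [mem_spineEdge_one]
  constructor
  · rintro ⟨hv, i, -, rfl⟩
    exact (h.le_last _ hv).antisymm (Nat.le_add_right K i)
  · rintro rfl
    exact ⟨h.last_mem, 0, h.zero_mem, rfl⟩

lemma HGraph.IsThinDigram.mem_ext_leafEdge (hd : d.IsThinDigram ⟨Z, π⟩ (leafEdge i)) (hi : i ∈ π) :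
    v ∈ d.ext ↔ v ∈ π ∧ v ≠ i := by
  rw [hd.mem_ext, mem_att_and_mem_leafEdge_iff hi, hd.mem_V, mem_leafEdge]
  lia

lemma HGraph.IsThinDigram.mem_ext_spineEdge_one (hd : d.IsThinDigram ⟨Z, π⟩ (spineEdge K Z π 1))
    (h : IsSpinePattern K Z π) (hπ : π.length = 2) : v ∈ d.ext ↔ v = 0 ∨ v = 2 * K := by
  have hK := h.pos
  rw [hd.mem_ext, mem_att_and_mem_spineEdge_one_iff h, hd.mem_V, mem_spineEdge_one]
  simp only [h.mem_iff_of_length_eq_two hπ, exists_eq_or_imp, exists_eq_left]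
  lia

lemma HGraph.IsThinDigram.isSpinePattern_of_leafEdge (hd : d.IsThinDigram ⟨Z, π⟩ (leafEdge i))
    (h : IsSpinePattern K Z π) (hi : i ∈ π) (hi0 : i ≠ 0) (hiK : i ≠ K) (hA : A.rank = d.rank)
    (hleaf : A ≠ .term 0 1) : IsSpinePattern K A d.ext where
  pos := h.pos
  nodup := hd.isDigram.1.ext_nodup
  zero_mem := (hd.mem_ext_leafEdge hi).2 ⟨h.zero_mem, hi0.symm⟩
  last_mem := (hd.mem_ext_leafEdge hi).2 ⟨h.last_mem, hiK.symm⟩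
  le_last v hv := h.le_last v ((hd.mem_ext_leafEdge hi).1 hv).1
  rank_eq := hA
  ne_leaf := hleaf

lemma HGraph.IsThinDigram.isSpinePattern_of_spineEdge_one
    (hd : d.IsThinDigram ⟨Z, π⟩ (spineEdge K Z π 1)) (h : IsSpinePattern K Z π)
    (hπ : π.length = 2) (hA : A.rank = d.rank) (hleaf : A ≠ .term 0 1) :
    IsSpinePattern (2 * K) A d.ext where
  pos := Nat.mul_pos two_pos h.pos
  nodup := hd.isDigram.1.ext_nodup
  zero_mem := (hd.mem_ext_spineEdge_one h hπ).2 (.inl rfl)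
  last_mem := (hd.mem_ext_spineEdge_one h hπ).2 (.inr rfl)
  le_last v hv := by
    rcases (hd.mem_ext_spineEdge_one h hπ).1 hv with rfl | rfl
    exacts [Nat.zero_le _, le_rfl]
  rank_eq := hA
  ne_leaf := hleaf

lemma leafNodes_val_eq_add {ρ : List ℕ} {B : Symb} (h : IsSpinePattern K Z π)
    (hρ : IsSpinePattern K B ρ) (hi : i ∈ π) (hi0 : i ≠ 0) (hiK : i ≠ K)
    (hmem : ∀ v, v ∈ ρ ↔ v ∈ π ∧ v ≠ i) :
    (leafNodes m K π).val =
      (leafNodes m K ρ).val + (Multiset.range m).map fun t => shift K t i := by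
  have hi' : i < K := (h.le_last i hi).lt_of_ne hiK
  have hinj : Function.Injective fun t => shift K t i := fun s t hst =>
    ((shift_eq_shift_iff hi' hi').1 hst).1
  refine (Multiset.Nodup.ext (leafNodes m K π).nodup (Multiset.nodup_add.2
    ⟨(leafNodes m K ρ).nodup, (Multiset.nodup_range m).map hinj, ?_⟩)).2 fun v => ?_
  · refine Multiset.disjoint_right.2 fun hv hv' => ?_
    obtain ⟨t, -, rfl⟩ := Multiset.mem_map.1 hv
    have := (shift_mem_leafNodes_iff hρ hi').1 hv'
    have := hmem i
    lia
  · obtain ⟨t, j, hj, rfl⟩ := exists_shift_eq h.pos v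
    have hi_iff : shift K t j ∈ (Multiset.range m).map (fun s => shift K s i) ↔ t < m ∧ j = i := by
      simp only [Multiset.mem_map, Multiset.mem_range, shift_eq_shift_iff hj hi']
      exact ⟨fun ⟨_, hs, hst, hij⟩ => ⟨hst ▸ hs, hij.symm⟩, fun ⟨ht, hji⟩ => ⟨t, ht, rfl, hji.symm⟩⟩
    rw [Multiset.mem_add, Finset.mem_val, Finset.mem_val, hi_iff, shift_mem_leafNodes_iff h hj,
      shift_mem_leafNodes_iff hρ hj, hmem]
    grind

lemma replaceOccs_leafEdge (h : IsSpinePattern K Z π) (hd : d.IsThinDigram ⟨Z, π⟩ (leafEdge i))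
    (hA : IsSpinePattern K A d.ext) (hi : i ∈ π) (hi0 : i ≠ 0) (hiK : i ≠ K)
    (hT : (T : Multiset ℕ) = .range m) :
    replaceOccs (spineGraph m K Z π) d A (T.map (shift K)) = spineGraph m K A d.ext := by
  have hi' : i < K := (h.le_last i hi).lt_of_ne hiK
  have hmemT (t : ℕ) : t ∈ T ↔ t < m := by rw [← Multiset.mem_coe, hT, Multiset.mem_range]
  rw [replaceOccs_map_shift hd fun v => mem_att_and_mem_leafEdge_iff hi, spineGraph, spineGraph,
    HGraph.mk.injEq, hT]
  refine ⟨?_, ?_, rfl⟩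
  · ext v
    obtain ⟨t, j, hj, rfl⟩ := exists_shift_eq h.pos v
    have hremoved : (∀ s ∈ T, shift K t j ≠ shift K s i) ↔ ¬ (t < m ∧ j = i) := by
      simp only [hmemT, ne_eq, shift_eq_shift_iff hi' hj]
      exact ⟨fun H ⟨ht, hji⟩ => H t ht ⟨rfl, hji⟩, fun H s hs ⟨hts, hji⟩ => H ⟨hts ▸ hs, hji⟩⟩
    rw [Finset.mem_filter, hremoved, shift_mem_spineNodes_iff h hj,
      shift_mem_spineNodes_iff hA hj, hd.mem_ext_leafEdge hi]
    lia
  · rw [leafNodes_val_eq_add h hA hi hi0 hiK fun v => hd.mem_ext_leafEdge hi, Multiset.map_add,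
      Multiset.map_map, ← add_assoc, add_right_comm]
    exact (congrArg (· + _) (add_tsub_cancel_left _ _)).trans (add_comm _ _)

lemma shift_two_mul (K t v : ℕ) : shift (2 * K) t v = shift K (2 * t) v := by
  simp only [shift]
  ring

lemma leafNodes_of_length_eq_two (h : IsSpinePattern K Z π) (hπ : π.length = 2) (hm : 0 < m) :
    leafNodes m K π = {shift K m 0} := by
  ext v
  obtain ⟨t, i, hi, rfl⟩ := exists_shift_eq h.pos v
  rw [shift_mem_leafNodes_iff h hi, Finset.mem_singleton, shift_eq_shift_iff h.pos hi,
    h.mem_iff_of_length_eq_two hπ]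
  lia

lemma mem_spineNodes_of_length_eq_two (h : IsSpinePattern K Z π) (hπ : π.length = 2) (hm : 0 < m) :
    v ∈ spineNodes m K π ↔ ∃ t ≤ m, v = shift K t 0 := by
  obtain ⟨t, i, hi, rfl⟩ := exists_shift_eq h.pos v
  simp only [shift_mem_spineNodes_iff h hi, h.mem_iff_of_length_eq_two hπ,
    shift_eq_shift_iff h.pos hi]
  constructor
  · exact fun hti => ⟨t, by lia, rfl, by lia⟩
  · rintro ⟨_, ht, rfl, rfl⟩
    lia

lemma map_two_mul_add_map_succ (s : ℕ) : (Multiset.range s).map (2 * ·) +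
    ((Multiset.range s).map (2 * ·)).map Nat.succ = .range (2 * s) := by
  induction s with
  | zero => rfl
  | succ s ih =>
    rw [Nat.mul_succ, Multiset.range_succ, Multiset.range_succ, Multiset.range_succ, ← ih]
    simp only [Multiset.map_cons, Multiset.cons_add, Multiset.add_cons]

lemma add_map_succ_injective : Function.Injective fun M : Multiset ℕ => M + M.map Nat.succ := by
  have hcount (M : Multiset ℕ) (v : ℕ) :
      (M + M.map Nat.succ).count (v + 1) = M.count (v + 1) + M.count v := by
    rw [Multiset.count_add, Multiset.count_map_eq_count' _ _ Nat.succ_injective]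
  have hcount_zero (M : Multiset ℕ) : (M + M.map Nat.succ).count 0 = M.count 0 := by
    rw [Multiset.count_add, Multiset.count_eq_zero_of_notMem (s := M.map _) (by simp), add_zero]
  intro M N (hMN : M + M.map Nat.succ = N + N.map Nat.succ)
  ext v
  induction v with
  | zero => rw [← hcount_zero M, ← hcount_zero N, hMN]
  | succ v ih =>
    have hv := congrArg (Multiset.count (v + 1)) hMN
    rw [hcount, hcount, ih] at hv
    exact Nat.add_right_cancel hv

lemma eq_map_two_mul_of_add_map_succ_le {M : Multiset ℕ} (hM : M + M.map Nat.succ ≤ .range (2 * s))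
    (hs : s ≤ M.card) : M = (Multiset.range s).map (2 * ·) := by
  have heq : M + M.map Nat.succ = .range (2 * s) := Multiset.eq_of_le_of_card_le hM <| by
    rw [Multiset.card_range, Multiset.card_add, Multiset.card_map]
    lia
  exact add_map_succ_injective (heq.trans (map_two_mul_add_map_succ s).symm)

lemma replaceOccs_spineEdge_one (h : IsSpinePattern K Z π) (hπ : π.length = 2)
    (hd : d.IsThinDigram ⟨Z, π⟩ (spineEdge K Z π 1)) (hA : IsSpinePattern (2 * K) A d.ext)
    (hext : d.ext.length = 2) (hs : 0 < s)
    (hT : (T : Multiset ℕ) = (Multiset.range s).map (2 * ·)) :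
    replaceOccs (spineGraph (2 * s) K Z π) d A (T.map (shift K)) =
      spineGraph s (2 * K) A d.ext := by
  have hmemT (t : ℕ) : t ∈ T ↔ ∃ a < s, 2 * a = t := by
    simp only [← Multiset.mem_coe, hT, Multiset.mem_map, Multiset.mem_range]
  rw [replaceOccs_map_shift hd fun v => mem_att_and_mem_spineEdge_one_iff h, spineGraph, spineGraph,
    HGraph.mk.injEq]
  refine ⟨?_, ?_, rfl⟩
  · ext v
    rw [Finset.mem_filter, mem_spineNodes_of_length_eq_two h hπ (by lia),
      mem_spineNodes_of_length_eq_two hA hext hs]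
    simp only [hmemT, shift_last, shift_two_mul]
    constructor
    · rintro ⟨⟨t, ht, rfl⟩, hodd⟩
      obtain ⟨a, rfl | rfl⟩ := t.even_or_odd'
      exacts [⟨a, by lia, rfl⟩, absurd rfl (hodd (2 * a) ⟨a, by lia, rfl⟩)]
    · rintro ⟨t, ht, rfl⟩
      refine ⟨⟨2 * t, by lia, rfl⟩, ?_⟩
      rintro _ ⟨a, -, rfl⟩ hta
      have := ((shift_eq_shift_iff h.pos h.pos).1 hta).1
      lia
  · rw [leafNodes_of_length_eq_two h hπ (by lia), leafNodes_of_length_eq_two hA hext hs,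
      shift_two_mul, ← map_two_mul_add_map_succ, ← hT, Multiset.map_add, Multiset.map_map]
    simp only [← spineEdge_succ]
    have hA_edges : (T : Multiset ℕ).map (spineEdge K A d.ext) =
        (Multiset.range s).map (spineEdge (2 * K) A d.ext) := by
      rw [hT, Multiset.map_map]
      exact Multiset.map_congr rfl fun t _ =>
        Edge.rename_congr fun v _ => (shift_two_mul K t v).symm
    rw [hA_edges]
    exact (congrArg (· + _) (add_tsub_cancel_left _ _)).trans (add_comm _ _)

end Replacement

/-! ### The replacement loop on spine graphs -/

/-- A bound on the total size of the rules which the replacement loop creates when it is started on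
a spine with `2 ^ j` edges. -/
def spineCost (j : ℕ) (π : List ℕ) : ℕ := (π.length + 2) ^ 2 + 5 * j

section SpineLoop

variable {d : HGraph} {f : Edge} {r : ℕ∞} {m s j K i : ℕ} {A Z : Symb} {π T : List ℕ}
  {G G' : Grammar}

lemma HGraph.IsThinDigram.rank_add_one_of_leafEdge (hd : d.IsThinDigram ⟨Z, π⟩ (leafEdge i))
    (hi : i ∈ π) : d.rank + 1 = π.length :=
  Nat.add_right_cancel (m := 1) (hd.rank_add_two fun _ => mem_att_and_mem_leafEdge_iff hi)

lemma HGraph.IsThinDigram.rank_add_two_of_spineEdge_one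
    (hd : d.IsThinDigram ⟨Z, π⟩ (spineEdge K Z π 1)) (h : IsSpinePattern K Z π) :
    d.rank + 2 = π.length + π.length := by
  have hrank := hd.rank_add_two fun _ => mem_att_and_mem_spineEdge_one_iff h
  rwa [spineEdge, Edge.rename_rank] at hrank

lemma IsActive.length_le_of_spineGraph (h : IsSpinePattern K Z π)
    (hd : IsActive r (spineGraph m K Z π) d) : (π.length : ℕ∞) ≤ r + 1 := by
  obtain ⟨d₀, L, hmost, hL⟩ := hd.exists_isMostFrequent
  obtain ⟨d', f, T, hf, hd', hmost', -⟩ := hmost.exists_map_shift h (by lia)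
  have hlen : π.length ≤ d'.rank + 1 := by
    rcases hf with ⟨i, hi, -, rfl⟩ | rfl
    · exact (hd'.rank_add_one_of_leafEdge hi).ge
    · have := hd'.rank_add_two_of_spineEdge_one h
      have := h.two_le_length
      lia
  exact (Nat.cast_le.2 hlen).trans (by push_cast; gcongr; exact hmost'.2.1)

lemma IsSpinePattern.exists_isNonOverlapping_leafEdge (h : IsSpinePattern K Z π)
    (hπ : 2 < π.length) (m : ℕ) : ∃ d L, d.IsDigram ∧ d.rank + 1 = π.length ∧
      IsNonOverlapping (spineGraph m K Z π) d L ∧ L.length = m := by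
  obtain ⟨i, hi, hi0, hiK⟩ := h.exists_interior hπ
  obtain ⟨d, hd⟩ := HGraph.exists_isThinDigram (e₁ := ⟨Z, π⟩) (e₂ := leafEdge i) h.nodup
    (List.nodup_singleton i) h.rank_eq.symm rfl ⟨i, hi, mem_leafEdge.2 rfl⟩
    ⟨0, h.zero_mem, fun hmem => hi0 (mem_leafEdge.1 hmem).symm⟩
  have hi' : i < K := (h.le_last i hi).lt_of_ne hiK
  refine ⟨d, (List.range m).map (shift K), hd.isDigram, hd.rank_add_one_of_leafEdge hi,
    (isNonOverlapping_map_shift_leaf_iff h hd).2 ⟨le_rfl, ?_⟩, by simp⟩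
  refine (Multiset.le_iff_subset ((Multiset.nodup_range m).map fun s t hst =>
    ((shift_eq_shift_iff hi' hi').1 hst).1)).2 (Multiset.forall_mem_map_iff.2 fun t ht => ?_)
  exact (shift_mem_leafNodes_iff h hi').2 (.inl ⟨Multiset.mem_range.1 ht, hi, hi0⟩)

lemma IsSpinePattern.exists_isNonOverlapping_spineEdge_one (h : IsSpinePattern K Z π)
    (hπ : π.length = 2) (s : ℕ) : ∃ d L, d.IsDigram ∧ d.rank = 2 ∧
      IsNonOverlapping (spineGraph (2 * s) K Z π) d L ∧ L.length = s := by
  have hzero : 0 ∉ (spineEdge K Z π 1).att := by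
    have := h.pos
    rw [mem_spineEdge_one]
    lia
  obtain ⟨d, hd⟩ := HGraph.exists_isThinDigram (e₁ := ⟨Z, π⟩) (e₂ := spineEdge K Z π 1) h.nodup
    (h.nodup.map (shift_injective K 1)) h.rank_eq.symm
    ((Edge.rename_rank _ _).trans h.rank_eq.symm)
    ⟨K, (mem_att_and_mem_spineEdge_one_iff h).2 rfl⟩ ⟨0, h.zero_mem, hzero⟩
  have hrank := hd.rank_add_two_of_spineEdge_one h
  refine ⟨d, ((List.range s).map (2 * ·)).map (shift K), hd.isDigram, by lia,
    (isNonOverlapping_map_shift_next_iff h hd).2 ?_, by simp⟩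
  exact (map_two_mul_add_map_succ s).le

lemma IsMostFrequent.le_length_of_two_lt {L : List (ℕ → ℕ)} (h : IsSpinePattern K Z π)
    (hπ : 2 < π.length) (hr : (π.length : ℕ∞) ≤ r + 1)
    (hd : IsMostFrequent r (spineGraph m K Z π) d L) : m ≤ L.length := by
  obtain ⟨d', L', hd', hrank, hL', rfl⟩ := h.exists_isNonOverlapping_leafEdge hπ m
  refine hd.2.2.2 d' L' hd' ?_ hL'
  rw [← hrank, Nat.cast_add, Nat.cast_one] at hr
  exact (ENat.add_le_add_iff_right ENat.one_ne_top).1 hr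

lemma IsMostFrequent.le_length_of_eq_two {L : List (ℕ → ℕ)} (h : IsSpinePattern K Z π)
    (hπ : π.length = 2) (hr : 2 ≤ r)
    (hd : IsMostFrequent r (spineGraph (2 * s) K Z π) d L) : s ≤ L.length := by
  obtain ⟨d', L', hd', hrank, hL', rfl⟩ := h.exists_isNonOverlapping_spineEdge_one hπ s
  exact hd.2.2.2 d' L' hd' (by rwa [hrank]) hL'

lemma ne_last_of_isNonOverlapping (h : IsSpinePattern K Z π)
    (hd : d.IsThinDigram ⟨Z, π⟩ (leafEdge i))
    (hT : IsNonOverlapping (spineGraph m K Z π) d (T.map (shift K))) (hlen : 2 ≤ T.length) :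
    i ≠ K := by
  rintro rfl
  obtain ⟨hrange, hleaf⟩ := (isNonOverlapping_map_shift_leaf_iff h hd).1 hT
  have hlast (t : ℕ) (ht : t ∈ T) : t + 1 = m := by
    have hmem := Multiset.mem_of_le hleaf (Multiset.mem_map_of_mem _ (Multiset.mem_coe.2 ht))
    have htm := Multiset.mem_range.1 (Multiset.mem_of_le hrange ht)
    rw [shift_last, Finset.mem_val, shift_mem_leafNodes_iff h h.pos] at hmem
    lia
  have hnodup : T.Nodup :=
    Multiset.coe_nodup.1 (Multiset.nodup_of_le hrange (Multiset.nodup_range m))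
  have hsub : T.toFinset ⊆ {m - 1} := fun t ht => by
    have := hlast t (List.mem_toFinset.1 ht)
    exact Finset.mem_singleton.2 (by lia)
  have := Finset.card_le_card hsub
  rw [List.toFinset_card_of_nodup hnodup, Finset.card_singleton] at this
  lia

lemma IsMostFrequent.coe_eq_range (h : IsSpinePattern K Z π) (hr : (π.length : ℕ∞) ≤ r + 1)
    (hi : i ∈ π) (hi0 : i ≠ 0) (hiK : i ≠ K) (hd : d.IsThinDigram ⟨Z, π⟩ (leafEdge i))
    (hT : IsMostFrequent r (spineGraph m K Z π) d (T.map (shift K))) :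
    (T : Multiset ℕ) = .range m := by
  have hπ : 2 < π.length := h.two_le_length.lt_of_ne fun hπ =>
    ((h.mem_iff_of_length_eq_two hπ.symm).1 hi).elim hi0 hiK
  refine Multiset.eq_of_le_of_card_le ((isNonOverlapping_map_shift_leaf_iff h hd).1 hT.2.2.1).1 ?_
  simpa using hT.le_length_of_two_lt h hπ hr

lemma IsMostFrequent.length_eq_two (h : IsSpinePattern K Z π) (hr : (π.length : ℕ∞) ≤ r + 1)
    (hd : d.IsThinDigram ⟨Z, π⟩ (spineEdge K Z π 1))
    (hT : IsMostFrequent r (spineGraph m K Z π) d (T.map (shift K))) (hlen : 0 < T.length) :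
    π.length = 2 := by
  by_contra hπ
  have hle := Multiset.card_le_card ((isNonOverlapping_map_shift_next_iff h hd).1 hT.2.2.1)
  have hm := hT.le_length_of_two_lt h (h.two_le_length.lt_of_ne' hπ) hr
  simp only [Multiset.card_add, Multiset.card_map, Multiset.coe_card, Multiset.card_range,
    List.length_map] at hle hm
  lia

lemma IsMostFrequent.coe_eq_map_two_mul (h : IsSpinePattern K Z π) (hπ : π.length = 2)
    (hr : 2 ≤ r) (hd : d.IsThinDigram ⟨Z, π⟩ (spineEdge K Z π 1))
    (hT : IsMostFrequent r (spineGraph (2 * s) K Z π) d (T.map (shift K))) :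
    (T : Multiset ℕ) = (Multiset.range s).map (2 * ·) := by
  refine eq_map_two_mul_of_add_map_succ_le
    ((isNonOverlapping_map_shift_next_iff h hd).1 hT.2.2.1) ?_
  simpa using hT.le_length_of_eq_two h hπ hr

lemma HGraph.IsThinDigram.size_add_spineCost_le_of_leafEdge
    (hd : d.IsThinDigram ⟨Z, π⟩ (leafEdge i)) (hi : i ∈ π) (j : ℕ) :
    d.size + spineCost j d.ext ≤ spineCost j π := by
  have hlen : d.ext.length + 1 = π.length := hd.rank_add_one_of_leafEdge hi
  have hsize : d.size + 1 = π.length + 1 + (edgeSize π.length + 1) :=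
    hd.size_add_one fun _ => mem_att_and_mem_leafEdge_iff hi
  have hedge := edgeSize_le π.length
  rw [spineCost, spineCost]
  nlinarith

lemma HGraph.IsThinDigram.size_eq_five_of_spineEdge_one
    (hd : d.IsThinDigram ⟨Z, π⟩ (spineEdge K Z π 1)) (h : IsSpinePattern K Z π)
    (hπ : π.length = 2) : d.size = 5 := by
  have hsize := hd.size_add_one fun _ => mem_att_and_mem_spineEdge_one_iff h
  rw [spineEdge, Edge.rename_rank, Edge.rank, hπ, edgeSize, if_pos le_rfl] at hsize
  lia

lemma IsMostFrequent.exists_replaceOccs_eq_spineGraph (h : IsSpinePattern K Z π)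
    (hr : (π.length : ℕ∞) ≤ r + 1) (hr2 : 2 ≤ r) (hf : IsSpinePartner K Z π f)
    (hd : d.IsThinDigram ⟨Z, π⟩ f)
    (hT : IsMostFrequent r (spineGraph (2 ^ j) K Z π) d (T.map (shift K))) (hlen : 2 ≤ T.length)
    (hA : A.rank = d.rank) (hleaf : A ≠ .term 0 1) :
    ∃ j' K' π', IsSpinePattern K' A π' ∧ π'.length ≤ π.length ∧
      replaceOccs (spineGraph (2 ^ j) K Z π) d A (T.map (shift K)) = spineGraph (2 ^ j') K' A π' ∧
      d.size + spineCost j' π' ≤ spineCost j π := by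
  rcases hf with ⟨i, hi, hi0, rfl⟩ | rfl
  · have hiK := ne_last_of_isNonOverlapping h hd hT.2.2.1 hlen
    have hA := hd.isSpinePattern_of_leafEdge h hi hi0 hiK hA hleaf
    exact ⟨j, K, d.ext, hA, (Nat.le_succ _).trans (hd.rank_add_one_of_leafEdge hi).le,
      replaceOccs_leafEdge h hd hA hi hi0 hiK (hT.coe_eq_range h hr hi hi0 hiK hd),
      hd.size_add_spineCost_le_of_leafEdge hi j⟩
  · have hπ := hT.length_eq_two h hr hd (by lia)
    have hext : d.ext.length = 2 := by
      have : d.ext.length + 2 = π.length + π.length := hd.rank_add_two_of_spineEdge_one h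
      lia
    have hcard := Multiset.card_le_card ((isNonOverlapping_map_shift_next_iff h hd).1 hT.2.2.1)
    simp only [Multiset.card_add, Multiset.card_map, Multiset.coe_card,
      Multiset.card_range] at hcard
    obtain _ | j := j
    · lia
    rw [pow_succ'] at hT ⊢
    have hA := hd.isSpinePattern_of_spineEdge_one h hπ hA hleaf
    refine ⟨j, 2 * K, d.ext, hA, (hext.trans hπ.symm).le, replaceOccs_spineEdge_one h hπ hd hA hext
      (by positivity) (hT.coe_eq_map_two_mul h hπ hr2 hd), ?_⟩
    rw [hd.size_eq_five_of_spineEdge_one h hπ, spineCost, spineCost, hext, hπ]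
    lia

lemma LoopStep.exists_spineGraph (h : IsSpinePattern K Z π) (hr : (π.length : ℕ∞) ≤ r + 1)
    (hr2 : 2 ≤ r) (hG : G.start = spineGraph (2 ^ j) K Z π) (hstep : LoopStep r G G') :
    ∃ j' K' Z' π', IsSpinePattern K' Z' π' ∧ π'.length ≤ π.length ∧
      G'.start = spineGraph (2 ^ j') K' Z' π' ∧
      (G'.rules.map fun p => p.2.size).sum + spineCost j' π' ≤
        (G.rules.map fun p => p.2.size).sum + spineCost j π := by
  obtain ⟨d, L, i, hmost, hL, -, rfl⟩ := hstep
  rw [hG] at hmost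
  obtain ⟨d', f, T, hf, hd', hT, hlen, hrank, hsize, hreplace⟩ := hmost.exists_map_shift h (by lia)
  obtain ⟨j', K', π', hA, hπ, heq, hcost⟩ := hT.exists_replaceOccs_eq_spineGraph
    (A := .nonterm i d.rank) h hr hr2 hf hd' (hlen ▸ hL) hrank nofun
  refine ⟨j', K', _, π', hA, hπ, by rw [hG, hreplace, heq], ?_⟩
  rw [Multiset.map_cons, Multiset.sum_cons]
  lia

lemma exists_spineGraph_of_reflTransGen (h : IsSpinePattern K Z π)
    (hr : (π.length : ℕ∞) ≤ r + 1) (hr2 : 2 ≤ r)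
    (hG : Relation.ReflTransGen (LoopStep r) (.ofGraph (spineGraph (2 ^ j) K Z π)) G) :
    ∃ j' K' Z' π', IsSpinePattern K' Z' π' ∧ π'.length ≤ π.length ∧
      G.start = spineGraph (2 ^ j') K' Z' π' ∧
      (G.rules.map fun p => p.2.size).sum + spineCost j' π' ≤ spineCost j π := by
  induction hG with
  | refl => exact ⟨j, K, Z, π, h, le_rfl, rfl, (zero_add _).le⟩
  | tail _ hstep ih =>
    obtain ⟨j₁, K₁, Z₁, π₁, h₁, hπ₁, hG₁, hcost₁⟩ := ih
    obtain ⟨j₂, K₂, Z₂, π₂, h₂, hπ₂, hG₂, hcost₂⟩ :=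
      hstep.exists_spineGraph h₁ ((Nat.cast_le.2 hπ₁).trans hr) hr2 hG₁
    exact ⟨j₂, K₂, Z₂, π₂, h₂, hπ₂.trans hπ₁, hG₂, hcost₂.trans hcost₁⟩

lemma LoopResult.start_isConnected_of_spineGraph (h : IsSpinePattern K Z π)
    (hr : (π.length : ℕ∞) ≤ r + 1) (hr2 : 2 ≤ r)
    (hG : LoopResult r (.ofGraph (spineGraph (2 ^ j) K Z π)) G) : G.start.IsConnected := by
  obtain ⟨_, _, _, _, h', -, hstart, -⟩ := exists_spineGraph_of_reflTransGen h hr hr2 hG.1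
  exact hstart ▸ spineGraph_isConnected h'

lemma IsSpinePattern.exists_isActive (h : IsSpinePattern K Z π) (hr : (π.length : ℕ∞) ≤ r + 1)
    (hr2 : 2 ≤ r) (hs : 2 ≤ s) : ∃ d, IsActive r (spineGraph (2 * s) K Z π) d := by
  rcases h.two_le_length.eq_or_lt with hπ | hπ
  · obtain ⟨d, L, hd, hrank, hL, rfl⟩ := h.exists_isNonOverlapping_spineEdge_one hπ.symm s
    exact ⟨d, hd, by rwa [hrank], L, hL, hs⟩
  · obtain ⟨d, L, hd, hrank, hL, hlen⟩ := h.exists_isNonOverlapping_leafEdge hπ (2 * s)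
    rw [← hrank, Nat.cast_add, Nat.cast_one] at hr
    exact ⟨d, hd, (ENat.add_le_add_iff_right ENat.one_ne_top).1 hr, L, hL, by lia⟩

lemma LoopResult.size_le_of_spineGraph (h : IsSpinePattern K Z π) (hr : (π.length : ℕ∞) ≤ r + 1)
    (hr2 : 2 ≤ r) (hG : LoopResult r (.ofGraph (spineGraph (2 ^ j) K Z π)) G) :
    G.size ≤ 2 * (3 * π.length + 1) + spineCost j π := by
  obtain ⟨j', K', Z', π', h', hπ, hstart, hcost⟩ := exists_spineGraph_of_reflTransGen h hr hr2 hG.1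
  have hj : 2 ^ j' ≤ 2 := by
    obtain _ | _ | j' := j'
    · exact one_le_two
    · exact le_rfl
    obtain ⟨d, hd⟩ := h'.exists_isActive (s := 2 ^ (j' + 1)) ((Nat.cast_le.2 hπ).trans hr) hr2
      (Nat.le_self_pow j'.succ_ne_zero 2)
    exact absurd (by rwa [hstart, pow_succ']) (hG.2 d)
  have hsize : G.start.size ≤ 2 * (3 * π.length + 1) := hstart ▸
    (spineGraph_size_le _ _ _ _).trans (Nat.mul_le_mul hj (by lia))
  rw [Grammar.size]
  lia

end SpineLoop

/-! ### Tree-graphs of right combs -/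

lemma OrdTree.rootPositions_replicate_append (j : ℕ) (c : OrdTree) (s : ℕ) :
    OrdTree.rootPositions (List.replicate j (.node 0 []) ++ [c]) s = List.range' s (j + 1) := by
  induction j generalizing s with
  | zero => rfl
  | succ j ih =>
    rw [List.replicate_succ, List.cons_append, OrdTree.rootPositions, ih]
    rfl

lemma OrdTree.numNodesList_replicate_append (j : ℕ) (c : OrdTree) :
    OrdTree.numNodesList (List.replicate j (.node 0 []) ++ [c]) = j + c.numNodes := by
  induction j with
  | zero => simp [OrdTree.numNodesList]
  | succ j ih =>
    rw [List.replicate_succ, List.cons_append, OrdTree.numNodesList, ih]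
    simp only [OrdTree.numNodes, OrdTree.numNodesList]
    lia

lemma OrdTree.graphEdgesList_replicate_append (j : ℕ) (c : OrdTree) (s : ℕ) :
    OrdTree.graphEdgesList (List.replicate j (.node 0 []) ++ [c]) s =
      (Multiset.range j).map (fun i => leafEdge (s + i)) + c.graphEdges (s + j) := by
  induction j generalizing s with
  | zero => simp [OrdTree.graphEdgesList]
  | succ j ih =>
    rw [List.replicate_succ, List.cons_append, OrdTree.graphEdgesList, ih, add_comm j 1,
      Multiset.range_add, Multiset.map_add, Multiset.map_map, add_assoc]
    simp only [OrdTree.numNodes, OrdTree.numNodesList, add_zero, Function.comp_def, ← add_assoc]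
    rfl

lemma comb_numNodes {k : ℕ} (hk : 1 ≤ k) (m : ℕ) : (comb k m).numNodes = m * k + 1 := by
  induction m with
  | zero => simp [comb, OrdTree.numNodes, OrdTree.numNodesList]
  | succ m ih =>
    rw [comb, OrdTree.numNodes, OrdTree.numNodesList_replicate_append, ih, Nat.succ_mul]
    lia

/-- The positions of the leaves of the right comb with `m` inner nodes of rank `k`. -/
def combLeaves (k m : ℕ) : Multiset ℕ :=
  (Multiset.range (m * k + 1)).filter fun v => v = m * k ∨ v % k ≠ 0

lemma combLeaves_succ {k : ℕ} (hk : 1 ≤ k) (m : ℕ) : combLeaves k (m + 1) =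
    (Multiset.range (k - 1)).map (1 + ·) + (combLeaves k m).map (k + ·) := by
  have hrange : Multiset.range ((m + 1) * k + 1) =
      {0} + (Multiset.range (k - 1)).map (1 + ·) + (Multiset.range (m * k + 1)).map (k + ·) := by
    rw [show (m + 1) * k + 1 = 1 + (k - 1) + (m * k + 1) by rw [add_one_mul]; lia,
      Multiset.range_add, Multiset.range_add, Nat.add_sub_cancel' hk]
    rfl
  have hroot : ({0} : Multiset ℕ).filter (fun v => v = (m + 1) * k ∨ v % k ≠ 0) = 0 :=
    Multiset.filter_eq_nil.2 fun v hv => by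
      rw [Multiset.mem_singleton.1 hv, Nat.zero_mod]
      have : 0 < (m + 1) * k := by positivity
      lia
  have hfirst : ((Multiset.range (k - 1)).map (1 + ·)).filter
      (fun v => v = (m + 1) * k ∨ v % k ≠ 0) = (Multiset.range (k - 1)).map (1 + ·) :=
    Multiset.filter_eq_self.2 <| Multiset.forall_mem_map_iff.2 fun v hv => by
      have := Multiset.mem_range.1 hv
      rw [Nat.mod_eq_of_lt (by lia)]
      lia
  have hrest : (fun v => v = (m + 1) * k ∨ v % k ≠ 0) ∘ (k + ·) =
      fun v => v = m * k ∨ v % k ≠ 0 := by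
    funext v
    simp only [Function.comp_apply, Nat.add_mod_right, add_one_mul, add_comm k, add_left_inj]
  rw [combLeaves, hrange, Multiset.filter_add, Multiset.filter_add, hroot, hfirst, zero_add,
    Multiset.filter_map]
  simp only [hrest, combLeaves]

lemma comb_graphEdges {k : ℕ} (hk : 1 ≤ k) (m s : ℕ) :
    (comb k m).graphEdges s =
      (Multiset.range m).map
        (fun t => ⟨.term 1 (k + 1), List.range' (s + t * k) (k + 1)⟩) +
      (combLeaves k m).map fun v => leafEdge (s + v) := by
  induction m generalizing s with
  | zero =>
    simp [comb, combLeaves, OrdTree.graphEdges, OrdTree.graphEdgesList, OrdTree.rootPositions,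
      leafEdge, Multiset.filter_singleton]
  | succ m ih =>
    have hlen : (List.replicate (k - 1) (OrdTree.node 0 []) ++ [comb k m]).length = k := by
      rw [List.length_append, List.length_replicate, List.length_singleton, Nat.sub_add_cancel hk]
    have hstart : s + 1 + (k - 1) = s + k := by lia
    have hnext (t : ℕ) : s + k + t * k = s + (1 + t) * k := by ring
    rw [comb, OrdTree.graphEdges, OrdTree.graphEdgesList_replicate_append,
      OrdTree.rootPositions_replicate_append, hlen, Nat.sub_add_cancel hk, hstart, ih,
      combLeaves_succ hk, add_comm m 1, Multiset.range_add, ← List.range'_succ,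
      Multiset.map_add, Multiset.map_add, Multiset.map_map, Multiset.map_map, Multiset.map_map]
    simp only [hnext, Function.comp_def, ← add_assoc]
    have hroot : (Multiset.range 1).map
          (fun t => (⟨.term 1 (k + 1), List.range' (s + t * k) (k + 1)⟩ : Edge)) =
        {⟨.term 1 (k + 1), List.range' s (k + 1)⟩} := by
      rw [Multiset.range_succ, Multiset.range_zero, Multiset.map_cons, Multiset.map_zero, zero_mul,
        add_zero, Multiset.cons_zero]
    rw [hroot, ← Multiset.singleton_add]
    abel

lemma isSpinePattern_range {k : ℕ} (hk : 1 ≤ k) :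
    IsSpinePattern k (.term 1 (k + 1)) (List.range (k + 1)) where
  pos := hk
  nodup := List.nodup_range
  zero_mem := List.mem_range.2 k.succ_pos
  last_mem := List.mem_range.2 k.lt_succ_self
  le_last _ hi := Nat.lt_succ_iff.1 (List.mem_range.1 hi)
  rank_eq := List.length_range.symm
  ne_leaf := nofun

lemma shift_lt_iff {k m t i : ℕ} (hi : i < k) :
    shift k t i < m * k + 1 ↔ t < m ∨ t = m ∧ i = 0 := by
  rw [shift]
  rcases lt_trichotomy t m with h | rfl | h
  · have := Nat.mul_le_mul_right k (Nat.succ_le_of_lt h)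
    rw [Nat.succ_mul] at this
    lia
  · lia
  · have := Nat.mul_le_mul_right k (Nat.succ_le_of_lt h)
    rw [Nat.succ_mul] at this
    lia

lemma spineNodes_range {k m : ℕ} (hk : 1 ≤ k) (hm : 0 < m) :
    spineNodes m k (List.range (k + 1)) = Finset.range (m * k + 1) := by
  ext v
  obtain ⟨t, i, hi, rfl⟩ := exists_shift_eq hk v
  rw [shift_mem_spineNodes_iff (isSpinePattern_range hk) hi, List.mem_range, Finset.mem_range,
    shift_lt_iff hi]
  lia

lemma leafNodes_range {k m : ℕ} (hk : 1 ≤ k) (hm : 0 < m) :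
    (leafNodes m k (List.range (k + 1))).val = combLeaves k m := by
  refine ((Finset.nodup _).ext ((Multiset.nodup_range _).filter _)).2 fun v => ?_
  obtain ⟨t, i, hi, rfl⟩ := exists_shift_eq hk v
  have hlast : shift k t i = m * k ↔ t = m ∧ i = 0 := by
    simpa only [shift, add_zero] using shift_eq_shift_iff (t := m) (i := 0) hk hi
  have hmod : shift k t i % k = i := by rw [shift, Nat.mul_add_mod', Nat.mod_eq_of_lt hi]
  rw [Finset.mem_val, shift_mem_leafNodes_iff (isSpinePattern_range hk) hi, List.mem_range,
    Multiset.mem_filter, Multiset.mem_range, shift_lt_iff hi, hlast, hmod]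
  lia

lemma combGraph_eq_spineGraph {k : ℕ} (hk : 1 ≤ k) (n : ℕ) :
    combGraph n k = spineGraph (2 ^ n) k (.term 1 (k + 1)) (List.range (k + 1)) := by
  have hedge (t : ℕ) : spineEdge k (.term 1 (k + 1)) (List.range (k + 1)) t =
      ⟨.term 1 (k + 1), List.range' (t * k) (k + 1)⟩ := by
    rw [List.range'_eq_map_range]
    rfl
  rw [combGraph, OrdTree.tGraph, spineGraph, comb_numNodes hk, comb_graphEdges hk,
    spineNodes_range hk (by positivity), leafNodes_range hk (by positivity)]
  simp only [zero_add, hedge]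

lemma combGraph_countLab_virt {k : ℕ} (hk : 1 ≤ k) (n : ℕ) :
    (combGraph n k).countLab .virt = 0 := by
  rw [combGraph_eq_spineGraph hk, HGraph.countLab_eq_zero]
  intro e he
  rcases mem_spineGraph_E.1 he with ⟨t, -, rfl⟩ | ⟨v, -, rfl⟩ <;> nofun

lemma LoopResult.size_le_of_combGraph {n k : ℕ} {r : ℕ∞} {G : Grammar} (hk : 1 ≤ k)
    (hkr : (k : ℕ∞) ≤ r) (hr2 : 2 ≤ r) (hG : LoopResult r (.ofGraph (combGraph n k)) G) :
    G.size ≤ 30 * (k ^ 2 + n) := by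
  rw [combGraph_eq_spineGraph hk] at hG
  have hsize := hG.size_le_of_spineGraph (isSpinePattern_range hk)
    (by rw [List.length_range, Nat.cast_add_one]; gcongr) hr2
  rw [spineCost, List.length_range] at hsize
  nlinarith [Nat.mul_le_mul_left k hk]

lemma LoopResult.start_isConnected_of_combGraph {n k : ℕ} {r : ℕ∞} {G : Grammar} (hk : 1 ≤ k)
    (hkr : (k : ℕ∞) ≤ r) (hr2 : 2 ≤ r) (hG : LoopResult r (.ofGraph (combGraph n k)) G) :
    G.start.IsConnected := by
  rw [combGraph_eq_spineGraph hk] at hG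
  exact hG.start_isConnected_of_spineGraph (isSpinePattern_range hk)
    (by rw [List.length_range, Nat.cast_add_one]; gcongr) hr2

lemma combGraph_not_isActive {n k : ℕ} {r : ℕ∞} (hk : 1 ≤ k) (hr : r < k) (d : HGraph) :
    ¬ IsActive r (combGraph n k) d := by
  rw [combGraph_eq_spineGraph hk]
  intro hd
  have hlen := hd.length_le_of_spineGraph (isSpinePattern_range hk)
  rw [List.length_range, Nat.cast_add_one, ENat.add_le_add_iff_right ENat.one_ne_top] at hlen
  exact hr.not_ge hlen

lemma combGraph_sound {k : ℕ} (hk : 1 ≤ k) (n : ℕ) : (combGraph n k).Sound :=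
  combGraph_eq_spineGraph hk n ▸ spineGraph_sound (isSpinePattern_range hk)

lemma combGraph_isConnected {k : ℕ} (hk : 1 ≤ k) (n : ℕ) : (combGraph n k).IsConnected :=
  combGraph_eq_spineGraph hk n ▸ spineGraph_isConnected (isSpinePattern_range hk)

end GRePair

theorem mainTheorem7 :
    (∃ C : ℕ, ∀ (n k : ℕ) (r : ℕ∞), 1 ≤ k → (k : ℕ∞) ≤ r → 2 ≤ r →
      (∃ G, GRePair.IsOutput r (GRePair.combGraph n k) G) ∧
      ∀ G, GRePair.IsOutput r (GRePair.combGraph n k) G → G.size ≤ C * (k ^ 2 + n)) ∧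
    (∀ (n k : ℕ) (r : ℕ∞), 1 ≤ k → r < (k : ℕ∞) →
      (∃ G, GRePair.IsOutput r (GRePair.combGraph n k) G) ∧
      ∀ G, GRePair.IsOutput r (GRePair.combGraph n k) G →
        G = GRePair.Grammar.ofGraph (GRePair.combGraph n k) ∧
        G.size = (GRePair.combGraph n k).size) := by
  refine ⟨⟨30, fun n k r hk hkr hr2 => ?_⟩, fun n k r hk hr => ?_⟩
  · have hsound := GRePair.combGraph_sound hk n
    refine ⟨hsound.exists_isOutput r, fun G hG => ?_⟩
    obtain ⟨G₁, hloop, hsize⟩ := hG.exists_loopResult_size_le hsound fun G₁ hloop =>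
      hloop.start_isConnected_of_combGraph hk hkr hr2
    exact hsize.trans (hloop.size_le_of_combGraph hk hkr hr2)
  · refine ⟨(GRePair.combGraph_sound hk n).exists_isOutput r, fun G hG => ?_⟩
    obtain rfl := hG.eq_ofGraph (GRePair.combGraph_isConnected hk n)
      (GRePair.combGraph_countLab_virt hk n) (GRePair.combGraph_not_isActive hk hr)
    exact ⟨rfl, by simp [GRePair.Grammar.size, GRePair.Grammar.ofGraph]⟩
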